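/- Let $\Bbbk$ be a field and $n\ge 0$. Let $\widetilde S_n$ be the Schur double cover of $S_n$, i.e. the group generated by $\zeta,s_1,\dots,s_{n-1}$ with relations $\zeta^2=1$, $\zeta s_i=s_i\zeta$, $s_i^2=\zeta$, $s_is_{i+1}s_i=s_{i+1}s_is_{i+1}$, and $s_is_j=\zeta s_js_i$ for $|i-j|\ge 2$; let $\varpi:\widetilde S_n\to S_n$ be the projection $\zeta\mapsto 1$, $s_i\mapsto (i,i+1)$. Let $\sigma\mapsto\widetilde\sigma$ be any set-theoretic section of $\varpi$, and let $c(\sigma,\tau)\in\{\pm1\}\subset\Bbbk^*$ be the corresponding cocycle: $c(\sigma,\tau)$ is $1$ or $-1$ according as $\widetilde{\sigma\tau}\,\widetilde\tau^{-1}\widetilde\sigma^{-1}$ is $1$ or $\zeta$. Grade $S_n$ by $\bar\sigma\in\mathbb Z/2$ with $(-1)^{\bar\sigma}=\operatorname{sgn}(\sigma)$. For commuting $\sigma,\tau\in S_n$ the supersymbol is $$e(\sigma,\tau)=(-1)^{\bar\sigma\bar\tau}\,\frac{c(\sigma,\tau)}{c(\tau,\sigma)}\in\Bbbk^*.$$ For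 a superrepresentation $\varrho$ of a group $H$ on a super vector space $V=V_{\bar0}\oplus V_{\bar1}$ let $\varrho\wr\operatorname{sgn}$ be the superrepresentation of $H\wr S_N=H^N\rtimes S_N$ on $V^{\otimes N}$ given by $$(h_1,\dots,h_N;\pi)\cdot(v_1\otimes\cdots\otimes v_N)=\operatorname{sgn}(\pi)\;\varrho(h_1)v_{\pi^{-1}(1)}\otimes\cdots\otimes\varrho(h_N)v_{\pi^{-1}(N)}$$ (with no further sign). For even $k$ let $\varrho_{\rm spin}$ be the $(0|1)$-dimensional superrepresentation of $\mathbb Z/k$ with character $\chi_{\rm spin}:\mathbb Z/k\to\{\pm1\}\subset\Bbbk^*$, $\chi_{\rm spin}(a)=(-1)^a$. **Theorem.** Let $\sigma\in S_n$ have $N_k$ cycles of length $k$ ($k\ge1$, fixed points being cycles of length $1$), so $n=\sum_k kN_k$. Number the cycles of each length $k$ by $j=1,\dots,N_k$ and choose a base point on each cycle, so that $\{1,\dots,n\}$ is identified with the set of triples $(k,j,a)$, $a\in\mathbb Z/k$, and $\sigma(k,j,a)=(k,j,a+1)$; such a choice exists. For every such choice, the action $(k,j,a)\mapsto(k,\pi_k(j),a+f_k(\pi_k(j)))$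 of $(f_k;\pi_k)_k$ is an isomorphism from $\prod_{k\ge1}\mathbb Z/k\wr S_{N_k}$ onto the centralizer $C_\sigma$ of $\sigma$ in $S_n$. Moreover $\tau\mapsto e(\sigma,\tau)$ is a homomorphism $C_\sigma\to\Bbbk^*$, and the one-dimensional superrepresentation of $C_\sigma$, of parity $\bar\sigma$, on which $\tau$ acts by $e(\sigma,\tau)$ is isomorphic, under the above isomorphism, to $$\bigotimes_{k\ \text{even}}\varrho_{\rm spin}\wr\operatorname{sgn}_{S_{N_k}},$$ where the factors $\mathbb Z/k\wr S_{N_k}$ with $k$ odd act trivially. In particular, the character is $$e(\sigma,\cdot)=\bigotimes_{k\ \text{even}}\chi_{\rm spin}\wr\operatorname{sgn}_{S_{N_k}}.$$ -/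

import Mathlib

open scoped TensorProduct

universe u

/-! ### The Schur double cover of the symmetric group -/

/-- Generators `ζ, s₁, …, sₙ₋₁` of the double cover; `s i` lies over the transposition of
the (0-based) letters `i` and `i + 1`. -/
inductive SchurGen (n : ℕ) : Type
  | zeta : SchurGen n
  | s (i : Fin (n - 1)) : SchurGen n

/-- The relators: `ζ² = 1`, `ζ sᵢ = sᵢ ζ`, `sᵢ² = ζ`, `sᵢ sᵢ₊₁ sᵢ = sᵢ₊₁ sᵢ sᵢ₊₁`, and
`sᵢ sⱼ = ζ sⱼ sᵢ` for `|i - j| ≥ 2`. -/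
inductive SchurRel (n : ℕ) : FreeGroup (SchurGen n) → Prop
  | zeta_sq : SchurRel n (FreeGroup.of .zeta * FreeGroup.of .zeta)
  | zeta_comm (i : Fin (n - 1)) : SchurRel n
      ((FreeGroup.of .zeta * FreeGroup.of (.s i)) *
        (FreeGroup.of (.s i) * FreeGroup.of .zeta)⁻¹)
  | s_sq (i : Fin (n - 1)) : SchurRel n
      ((FreeGroup.of (.s i) * FreeGroup.of (.s i)) * (FreeGroup.of .zeta)⁻¹)
  | braid (i j : Fin (n - 1)) (h : (i : ℕ) + 1 = j) : SchurRel n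
      ((FreeGroup.of (.s i) * FreeGroup.of (.s j) * FreeGroup.of (.s i)) *
        (FreeGroup.of (.s j) * FreeGroup.of (.s i) * FreeGroup.of (.s j))⁻¹)
  | far (i j : Fin (n - 1)) (h : (i : ℕ) + 2 ≤ j ∨ (j : ℕ) + 2 ≤ i) : SchurRel n
      ((FreeGroup.of (.s i) * FreeGroup.of (.s j)) *
        (FreeGroup.of .zeta * FreeGroup.of (.s j) * FreeGroup.of (.s i))⁻¹)

/-- The Schur double cover `S̃ₙ`. -/
abbrev SchurCover (n : ℕ) : Type := PresentedGroup {r | SchurRel n r}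

/-- The adjacent transposition `(i, i + 1)`. -/
def adjSwap (n : ℕ) (i : Fin (n - 1)) : Equiv.Perm (Fin n) :=
  Equiv.swap ⟨i, by omega⟩ ⟨i + 1, by omega⟩

/-- The images of the generators in `Sₙ`. -/
def SchurGen.toPerm {n : ℕ} : SchurGen n → Equiv.Perm (Fin n)
  | .zeta => 1
  | .s i => adjSwap n i

theorem SchurRel.lift_eq_one {n : ℕ} :
    ∀ r ∈ {r | SchurRel n r}, FreeGroup.lift (SchurGen.toPerm (n := n)) r = 1 := by
  rintro r (_ | i | i | ⟨i, j, h⟩ | ⟨i, j, h⟩)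
  · simp [SchurGen.toPerm]
  · simp [SchurGen.toPerm]
  · simp [SchurGen.toPerm, adjSwap]
  · simp only [map_mul, map_inv, FreeGroup.lift_apply_of, SchurGen.toPerm, adjSwap]
    rw [mul_inv_eq_one]
    have e : (⟨j, by omega⟩ : Fin n) = ⟨i + 1, by omega⟩ := by ext; simp [h]
    rw [e]
    rw [Equiv.swap_mul_swap_mul_swap (by simp [Fin.ext_iff]) (by simp [Fin.ext_iff]; omega)]
    rw [Equiv.swap_comm (⟨i, by omega⟩ : Fin n) ⟨i + 1, by omega⟩,
      Equiv.swap_comm (⟨i + 1, by omega⟩ : Fin n) ⟨j + 1, by omega⟩]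
    rw [Equiv.swap_mul_swap_mul_swap (by simp [Fin.ext_iff]; omega)
      (by simp [Fin.ext_iff]; omega)]
    rw [Equiv.swap_comm]
  · simp only [map_mul, map_inv, FreeGroup.lift_apply_of, SchurGen.toPerm, adjSwap, one_mul]
    rw [mul_inv_eq_one]
    refine (Equiv.Perm.Disjoint.commute ?_).eq
    rw [Equiv.Perm.disjoint_iff_disjoint_support,
      Equiv.Perm.support_swap (by simp [Fin.ext_iff]),
      Equiv.Perm.support_swap (by simp [Fin.ext_iff])]
    simp [Fin.ext_iff]
    omega

/-- The projection `ϖ : S̃ₙ → Sₙ`, `ζ ↦ 1`, `sᵢ ↦ (i, i + 1)`. -/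
def schurProj (n : ℕ) : SchurCover n →* Equiv.Perm (Fin n) :=
  PresentedGroup.toGroup SchurRel.lift_eq_one

theorem schurProj_surjective (n : ℕ) : Function.Surjective (schurProj n) := by
  rw [← MonoidHom.range_eq_top, eq_top_iff]
  rcases n with _ | m
  · intro x _
    rw [Subsingleton.elim x 1]
    exact one_mem _
  · intro x _
    have hx : x ∈ Submonoid.closure
        (Set.range fun i : Fin m => Equiv.swap i.castSucc i.succ) := by
      rw [Equiv.Perm.mclosure_swap_castSucc_succ]; trivial
    have hle : Submonoid.closure (Set.range fun i : Fin m => Equiv.swap i.castSucc i.succ) ≤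
        (schurProj (m + 1)).range.toSubmonoid := by
      rw [Submonoid.closure_le]
      rintro _ ⟨i, rfl⟩
      exact ⟨PresentedGroup.of (.s i), by
        simp only [schurProj, PresentedGroup.toGroup.of]; rfl⟩
    exact hle hx

/-! ### Cocycles and supersymbols -/

/-- The 2-cocycle of the double cover, pushed forward along `{±1} → 𝕜ˣ`, defined by a section
`ℓ` of `ϖ`: `ℓ(στ) ℓ(τ)⁻¹ ℓ(σ)⁻¹ ∈ {1, ζ}` is sent to `1` or `-1` respectively. -/
noncomputable def schurCocycle (𝕜 : Type u) [Field 𝕜] {n : ℕ}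
    (l : Equiv.Perm (Fin n) → SchurCover n) (σ τ : Equiv.Perm (Fin n)) : 𝕜ˣ :=
  open Classical in if l (σ * τ) * (l τ)⁻¹ * (l σ)⁻¹ = 1 then 1 else -1

/-- The `ℤ/2`-grading of `Sₙ` with `(-1)^(deg σ) = sgn σ`. -/
def permDeg {n : ℕ} (σ : Equiv.Perm (Fin n)) : ZMod 2 :=
  if Equiv.Perm.sign σ = 1 then 0 else 1

/-- The supersymbol `e(g,h) = (-1)^(deg g * deg h) c(g,h) / c(h,g)` of commuting elements of a
`ℤ/2`-graded group with 2-cocycle `c`. -/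
def supersymbol {𝕜 : Type u} [Field 𝕜] {G : Type*} (deg : G → ZMod 2) (c : G → G → 𝕜ˣ)
    (g h : G) : 𝕜ˣ :=
  (-1) ^ ((deg g).val * (deg h).val) * (c g h / c h g)

/-! ### Superrepresentations -/

/-- A superrepresentation of `G`: a super vector space `V = V₀ ⊕ V₁` with an action of `G` by
even linear maps. -/
structure SuperRep (𝕜 : Type u) [Field 𝕜] (G : Type*) [Group G] where
  V : Type u
  [addCommGroup : AddCommGroup V]
  [module : Module 𝕜 V]
  grading : ZMod 2 → Submodule 𝕜 V
  isCompl : IsCompl (grading 0) (grading 1)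
  ρ : Representation 𝕜 G V
  ρ_mem : ∀ (g : G) (d : ZMod 2) (v : V), v ∈ grading d → ρ g v ∈ grading d

attribute [instance] SuperRep.addCommGroup SuperRep.module

/-- An isomorphism of superrepresentations: an even equivariant linear isomorphism. -/
structure SuperRep.Iso {𝕜 : Type u} [Field 𝕜] {G : Type*} [Group G] (X Y : SuperRep 𝕜 G) where
  toEquiv : X.V ≃ₗ[𝕜] Y.V
  map_mem : ∀ (d : ZMod 2) (v : X.V), v ∈ X.grading d → toEquiv v ∈ Y.grading d
  map_ρ : ∀ (g : G) (v : X.V), toEquiv (X.ρ g v) = Y.ρ g (toEquiv v)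

/-- Restriction of a superrepresentation along a group homomorphism. -/
def SuperRep.comap {𝕜 : Type u} [Field 𝕜] {G H : Type*} [Group G] [Group H] (f : G →* H)
    (X : SuperRep 𝕜 H) : SuperRep 𝕜 G where
  V := X.V
  grading := X.grading
  isCompl := X.isCompl
  ρ := X.ρ.comp f
  ρ_mem g d v hv := X.ρ_mem (f g) d v hv

/-- The one-dimensional superrepresentation, concentrated in degree `d`, on which `G` acts by
the character `χ`. -/
def SuperRep.line {𝕜 : Type u} [Field 𝕜] {G : Type*} [Group G] (χ : G →* 𝕜ˣ) (d : ZMod 2) :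
    SuperRep 𝕜 G where
  V := 𝕜
  grading d' := if d' = d then ⊤ else ⊥
  isCompl := by
    fin_cases d
    · exact isCompl_top_bot (α := Submodule 𝕜 𝕜)
    · exact isCompl_bot_top (α := Submodule 𝕜 𝕜)
  ρ :=
    { toFun := fun g => LinearMap.mulLeft 𝕜 (χ g : 𝕜)
      map_one' := by ext; simp
      map_mul' := fun g h => by ext; simp }
  ρ_mem g d' v hv := by
    split_ifs at hv ⊢
    · trivial
    · have hv0 : v = 0 := by simpa using hv
      simp [hv0]

/-! ### Tensor products of super vector spaces -/

section TensorGrading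

variable {𝕜 : Type u} [Field 𝕜] {ι : Type} [Fintype ι]

/-- The degree `d` part of a tensor product of super vector spaces: it is spanned by the pure
tensors of homogeneous vectors whose degrees add up to `d`. -/
def tensorGrading {V : ι → Type u} [∀ i, AddCommGroup (V i)] [∀ i, Module 𝕜 (V i)]
    (gr : ∀ i, ZMod 2 → Submodule 𝕜 (V i)) (d : ZMod 2) : Submodule 𝕜 (⨂[𝕜] i, V i) :=
  Submodule.span 𝕜 {x | ∃ (e : ι → ZMod 2) (v : ∀ i, V i), ∑ i, e i = d ∧
    (∀ i, v i ∈ gr i (e i)) ∧ x = PiTensorProduct.tprod 𝕜 v}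

theorem tensorGrading_isCompl {V : ι → Type u} [∀ i, AddCommGroup (V i)]
    [∀ i, Module 𝕜 (V i)] (gr : ∀ i, ZMod 2 → Submodule 𝕜 (V i))
    (h : ∀ i, IsCompl (gr i 0) (gr i 1)) :
    IsCompl (tensorGrading gr 0) (tensorGrading gr 1) := by
  classical
  have hp : ∀ i, ∃ p : ZMod 2 → V i →ₗ[𝕜] V i, (∀ d v, p d v ∈ gr i d) ∧
      (∀ v, ∑ d, p d v = v) ∧ (∀ d v, v ∈ gr i d → ∀ d', p d' v = if d' = d then v else 0) := by
    intro i
    refine ⟨fun d => if d = 0 then (gr i 0).projection (gr i 1) (h i)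
      else (gr i 1).projection (gr i 0) (h i).symm, ?_, ?_, ?_⟩
    · intro d v
      fin_cases d
      · exact Submodule.projection_apply_mem (h i) v
      · exact Submodule.projection_apply_mem (h i).symm v
    · intro v
      have := Submodule.projection_add_projection_eq_self (h i) v
      rw [show (Finset.univ : Finset (ZMod 2)) = {0, 1} from rfl]
      simpa using this
    · intro d v hv d'
      fin_cases d <;> fin_cases d'
      · exact Submodule.projection_apply_left (h i) ⟨v, hv⟩
      · exact (Submodule.projection_apply_eq_zero_iff (h i).symm).2 hv
      · exact (Submodule.projection_apply_eq_zero_iff (h i)).2 hv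
      · exact Submodule.projection_apply_left (h i).symm ⟨v, hv⟩
  choose p hp1 hp2 hp3 using hp
  let Q : (⨂[𝕜] i, V i) →ₗ[𝕜] (⨂[𝕜] i, V i) :=
    ∑ f ∈ Finset.univ.filter (fun f : ι → ZMod 2 => ∑ i, f i = 0),
      PiTensorProduct.map (fun i => p i (f i))
  have hQ : ∀ (e : ι → ZMod 2) (v : ∀ i, V i), (∀ i, v i ∈ gr i (e i)) →
      Q (PiTensorProduct.tprod 𝕜 v) =
        if ∑ i, e i = 0 then PiTensorProduct.tprod 𝕜 v else 0 := by
    intro e v hv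
    have hterm : ∀ f : ι → ZMod 2, PiTensorProduct.map (fun i => p i (f i))
        (PiTensorProduct.tprod 𝕜 v) = if f = e then PiTensorProduct.tprod 𝕜 v else 0 := by
      intro f
      rw [PiTensorProduct.map_tprod]
      split_ifs with hf
      · subst hf
        congr 1
        ext i
        rw [hp3 i _ _ (hv i)]; simp
      · obtain ⟨i, hi⟩ := Function.ne_iff.1 hf
        apply MultilinearMap.map_coord_zero _ i
        rw [hp3 i _ _ (hv i)]; simp [hi]
    simp only [Q, LinearMap.sum_apply, hterm]
    rw [Finset.sum_ite_eq']
    simp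
  constructor
  · rw [Submodule.disjoint_def]
    intro x hx0 hx1
    have h0 : Q x = x := by
      have hle : tensorGrading gr 0 ≤ LinearMap.eqLocus Q LinearMap.id := by
        refine Submodule.span_le.2 ?_
        rintro _ ⟨e, v, he, hv, rfl⟩
        have := hQ e v hv
        simpa [he] using this
      exact hle hx0
    have h1 : Q x = 0 := by
      have hle : tensorGrading gr 1 ≤ LinearMap.ker Q := by
        refine Submodule.span_le.2 ?_
        rintro _ ⟨e, v, he, hv, rfl⟩
        have := hQ e v hv
        simpa [he] using this
      exact hle hx1
    rw [← h0, h1]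
  · rw [codisjoint_iff, eq_top_iff, ← PiTensorProduct.span_tprod_eq_top, Submodule.span_le]
    rintro _ ⟨v, rfl⟩
    have hv : v = fun i => ∑ d, p i d (v i) := by
      ext i; exact (hp2 i (v i)).symm
    rw [hv, MultilinearMap.map_sum]
    refine Submodule.sum_mem _ fun f _ => ?_
    have hmem : PiTensorProduct.tprod 𝕜 (fun i => p i (f i) (v i)) ∈
        tensorGrading gr (∑ i, f i) :=
      Submodule.subset_span ⟨f, _, rfl, fun i => hp1 i _ _, rfl⟩
    have hle : ∀ d : ZMod 2, tensorGrading gr d ≤ tensorGrading gr 0 ⊔ tensorGrading gr 1 := by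
      intro d
      fin_cases d
      · exact le_sup_left
      · exact le_sup_right
    exact hle _ hmem

theorem tensorGrading_map_mem {V : ι → Type u} [∀ i, AddCommGroup (V i)]
    [∀ i, Module 𝕜 (V i)] (gr : ∀ i, ZMod 2 → Submodule 𝕜 (V i))
    (f : ∀ i, V i →ₗ[𝕜] V i) (hf : ∀ i d v, v ∈ gr i d → f i v ∈ gr i d)
    (d : ZMod 2) (x : ⨂[𝕜] i, V i) (hx : x ∈ tensorGrading gr d) :
    PiTensorProduct.map f x ∈ tensorGrading gr d := by
  have hle : tensorGrading gr d ≤ (tensorGrading gr d).comap (PiTensorProduct.map f) := by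
    refine Submodule.span_le.2 ?_
    rintro _ ⟨e, v, he, hv, rfl⟩
    refine Submodule.subset_span ⟨e, fun i => f i (v i), he, fun i => hf _ _ _ (hv i), ?_⟩
    rw [PiTensorProduct.map_tprod]
  exact hle hx

theorem tensorGrading_reindex_mem {V : Type u} [AddCommGroup V] [Module 𝕜 V]
    (gr : ZMod 2 → Submodule 𝕜 V) (π : Equiv.Perm ι) (d : ZMod 2) (x : ⨂[𝕜] _ : ι, V)
    (hx : x ∈ tensorGrading (fun _ : ι => gr) d) :
    PiTensorProduct.reindex 𝕜 (fun _ : ι => V) π x ∈ tensorGrading (fun _ : ι => gr) d := by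
  have hle : tensorGrading (fun _ : ι => gr) d ≤ (tensorGrading (fun _ : ι => gr) d).comap
      (PiTensorProduct.reindex 𝕜 (fun _ : ι => V) π).toLinearMap := by
    refine Submodule.span_le.2 ?_
    rintro _ ⟨e, v, he, hv, rfl⟩
    refine Submodule.subset_span ⟨fun i => e (π.symm i), fun i => v (π.symm i), ?_,
      fun i => hv _, ?_⟩
    · rw [← he]; exact Equiv.sum_comp π.symm e
    · exact PiTensorProduct.reindex_tprod π v
  exact hle hx

end TensorGrading

/-- The external tensor product of superrepresentations `W i` of groups `G i`, a
superrepresentation of `∏ i, G i`. -/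
def SuperRep.tensor {𝕜 : Type u} [Field 𝕜] {ι : Type} [Fintype ι] {G : ι → Type}
    [∀ i, Group (G i)] (W : ∀ i, SuperRep 𝕜 (G i)) : SuperRep 𝕜 (∀ i, G i) where
  V := ⨂[𝕜] i, (W i).V
  grading := tensorGrading fun i => (W i).grading
  isCompl := tensorGrading_isCompl _ fun i => (W i).isCompl
  ρ :=
    { toFun := fun g => PiTensorProduct.map fun i => (W i).ρ (g i)
      map_one' := by simp only [Pi.one_apply, map_one]; exact PiTensorProduct.map_one
      map_mul' := fun g h => by
        simp only [Pi.mul_apply, map_mul]; exact PiTensorProduct.map_mul _ _ }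
  ρ_mem g d v hv := tensorGrading_map_mem _ _ (fun i d v => (W i).ρ_mem (g i) d v) d v hv

/-! ### Wreath products -/

/-- The wreath product `H ≀ S_N = H^N ⋊ S_N`, where `(π • f) j = f (π⁻¹ j)`. -/
abbrev Wreath (H : Type) [Group H] (N : ℕ) : Type :=
  (Fin N → H) ⋊[mulAutArrow] Equiv.Perm (Fin N)

/-- The operator by which `(f, π) ∈ H ≀ S_N` acts on `V^{⊗N}` in `ϱ ≀ sgn`: it sends
`v₁ ⊗ ⋯ ⊗ v_N` to `sgn(π) • ⨂ⱼ ϱ(fⱼ) v_{π⁻¹ j}`. The only sign is `sgn(π)`; there is no further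
Koszul sign. -/
noncomputable def wreathSgnMap {𝕜 : Type u} [Field 𝕜] {H : Type} [Group H] (X : SuperRep 𝕜 H)
    (N : ℕ) (w : Wreath H N) : (⨂[𝕜] _ : Fin N, X.V) →ₗ[𝕜] (⨂[𝕜] _ : Fin N, X.V) :=
  ((Equiv.Perm.sign w.right : ℤ) : 𝕜) • (PiTensorProduct.map (fun j => X.ρ (w.left j)) ∘ₗ
    (PiTensorProduct.reindex 𝕜 (fun _ : Fin N => X.V) w.right).toLinearMap)

theorem wreathSgnMap_tprod {𝕜 : Type u} [Field 𝕜] {H : Type} [Group H] (X : SuperRep 𝕜 H)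
    (N : ℕ) (w : Wreath H N) (v : Fin N → X.V) :
    wreathSgnMap X N w (PiTensorProduct.tprod 𝕜 v) = ((Equiv.Perm.sign w.right : ℤ) : 𝕜) •
      PiTensorProduct.tprod 𝕜 (fun j => X.ρ (w.left j) (v (w.right⁻¹ j))) := by
  simp only [wreathSgnMap, LinearMap.smul_apply, LinearMap.comp_apply, LinearEquiv.coe_coe]
  rw [PiTensorProduct.reindex_tprod, PiTensorProduct.map_tprod]
  rfl

/-- The superrepresentation `ϱ ≀ sgn` of `H ≀ S_N` on `V^{⊗N}`. -/
noncomputable def SuperRep.wreathSgn {𝕜 : Type u} [Field 𝕜] {H : Type} [Group H]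
    (X : SuperRep 𝕜 H) (N : ℕ) : SuperRep 𝕜 (Wreath H N) where
  V := ⨂[𝕜] _ : Fin N, X.V
  grading := tensorGrading fun _ => X.grading
  isCompl := tensorGrading_isCompl _ fun _ => X.isCompl
  ρ :=
    { toFun := wreathSgnMap X N
      map_one' := by
        refine PiTensorProduct.ext (MultilinearMap.ext fun v => ?_)
        simp only [LinearMap.compMultilinearMap_apply, wreathSgnMap_tprod]
        simp
      map_mul' := fun w w' => by
        refine PiTensorProduct.ext (MultilinearMap.ext fun v => ?_)
        simp only [LinearMap.compMultilinearMap_apply, Module.End.mul_apply,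
          wreathSgnMap_tprod, map_smul, smul_smul]
        simp [mul_comm]
        rfl }
  ρ_mem w d v hv := by
    refine Submodule.smul_mem _ _ ?_
    exact tensorGrading_map_mem _ _ (fun i d v => X.ρ_mem (w.left i) d v) d _
      (tensorGrading_reindex_mem _ _ d v hv)

/-! ### The spin characters -/

/-- For even `k`, the non-trivial homomorphism `ℤ/k → {±1} ⊆ 𝕜ˣ`, `a ↦ (-1)^a`. -/
def chiSpin (𝕜 : Type u) [Field 𝕜] (k : ℕ) (hk : Even k) : Multiplicative (ZMod k) →* 𝕜ˣ :=
  (Units.map (Int.castRingHom 𝕜).toMonoidHom).comp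
    { toFun := fun a => (-1 : ℤˣ) ^ (ZMod.castHom hk.two_dvd (ZMod 2) a.toAdd)
      map_one' := by simp
      map_mul' := fun a b => by rw [toAdd_mul, map_add, uzpow_add] }

/-- The `(0|1)`-dimensional superrepresentation `ϱ_spin` of `ℤ/k`. -/
def rhoSpin (𝕜 : Type u) [Field 𝕜] (k : ℕ) (hk : Even k) :
    SuperRep 𝕜 (Multiplicative (ZMod k)) :=
  SuperRep.line (chiSpin 𝕜 k hk) 1

/-! ### The centralizer of a permutation -/

/-- The number `N_k` of `k`-cycles of `σ`; fixed points count as 1-cycles. -/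
def numCycles {n : ℕ} (σ : Equiv.Perm (Fin n)) (k : ℕ) : ℕ :=
  σ.partition.parts.count k

/-- The abstract set on which a permutation with the cycle type of `σ` acts: the elements
`(k, j, a)`, where `1 ≤ k ≤ n`, `j` numbers the `k`-cycles and `a ∈ ℤ/k` is the position in the
cycle. -/
abbrev CycleSpace {n : ℕ} (σ : Equiv.Perm (Fin n)) : Type :=
  (k : Finset.Icc 1 n) × (Fin (numCycles σ k) × ZMod k)

/-- The group `∏ₖ ℤ/k ≀ S_{N_k}`; the factors with `k > n` are trivial and are left out. -/
abbrev CycleGroup {n : ℕ} (σ : Equiv.Perm (Fin n)) : Type :=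
  ∀ k : Finset.Icc 1 n, Wreath (Multiplicative (ZMod k)) (numCycles σ k)

/-- A numbering of the cycles of each length of `σ`, with a base point on each cycle. -/
structure CycleLabelling {n : ℕ} (σ : Equiv.Perm (Fin n)) where
  toEquiv : CycleSpace σ ≃ Fin n
  map_succ : ∀ (k : Finset.Icc 1 n) (j : Fin (numCycles σ k)) (a : ZMod k),
    σ (toEquiv ⟨k, j, a⟩) = toEquiv ⟨k, j, a + 1⟩

/-- The permutation `(k, j, a) ↦ (k, πₖ j, a + fₖ(πₖ j))` given by an element `(fₖ, πₖ)ₖ` of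
`∏ₖ ℤ/k ≀ S_{N_k}`. -/
def cycleAct {n : ℕ} {σ : Equiv.Perm (Fin n)} (w : CycleGroup σ) :
    Equiv.Perm (CycleSpace σ) where
  toFun x := ⟨x.1, (w x.1).right x.2.1,
    x.2.2 + ((w x.1).left ((w x.1).right x.2.1)).toAdd⟩
  invFun x := ⟨x.1, (w x.1).right⁻¹ x.2.1, x.2.2 - ((w x.1).left x.2.1).toAdd⟩
  left_inv := by rintro ⟨k, j, a⟩; simp
  right_inv := by rintro ⟨k, j, a⟩; simp

/-- The homomorphism `∏ₖ ℤ/k ≀ S_{N_k} → Sₙ` given by a labelling of the cycles of `σ`. -/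
def CycleLabelling.hom {n : ℕ} {σ : Equiv.Perm (Fin n)} (φ : CycleLabelling σ) :
    CycleGroup σ →* Equiv.Perm (Fin n) :=
  φ.toEquiv.permCongrHom.toMonoidHom.comp
    { toFun := cycleAct
      map_one' := by
        ext1 ⟨k, j, a⟩
        simp [cycleAct]
      map_mul' := fun w w' => by
        ext1 ⟨k, j, a⟩
        simp [cycleAct, add_comm, add_left_comm]
        exact congrArg (w' k).left ((w k).right.symm_apply_apply ((w' k).right j)) }

/-- The superrepresentation `⨂_{k even} ϱ_spin ≀ sgn_{S_{N_k}}` of `∏ₖ ℤ/k ≀ S_{N_k}`; the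
factors with `k` odd act trivially. -/
noncomputable def spinTensor (𝕜 : Type u) [Field 𝕜] {n : ℕ} (σ : Equiv.Perm (Fin n)) :
    SuperRep 𝕜 (CycleGroup σ) :=
  SuperRep.comap
    ({ toFun := fun w k => w k.1
       map_one' := rfl
       map_mul' := fun _ _ => rfl } : CycleGroup σ →*
      ∀ k : {k : Finset.Icc 1 n // Even (k : ℕ)},
        Wreath (Multiplicative (ZMod k.1)) (numCycles σ k.1))
    (SuperRep.tensor fun k : {k : Finset.Icc 1 n // Even (k : ℕ)} =>
      (rhoSpin 𝕜 k.1 k.2).wreathSgn (numCycles σ k.1))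

/-! ### The structure of the Schur double cover -/

/-! The cocycle quotient `c(σ,τ)/c(τ,σ)` is the sign by which lifts of the commuting `σ` and `τ`
commute in the double cover. This makes sense because the kernel of `ϖ` is exactly `{1, ζ}`: a
double coset induction along `s₀, s₁, …` shows that it is no larger
(`exists_zetaHom_of_schurProj_eq_one`), and a Clifford algebra shows `ζ ≠ 1` (`zeta_ne_one`). As `ζ`
is central, the sign does not depend on the lifts, is multiplicative in each argument and is
invariant under conjugation.

For disjoint permutations this sign is exactly the Koszul sign, so the supersymbol `superSign` is
trivial on disjoint pairs (`superSign_of_disjoint`). Hence, if `σ = zρ` and `τ` is disjoint from `ρ`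
and commutes with `z`, only `z` matters. If `τ = z` is a single cycle of `σ`, its lift commutes with
itself and the Koszul sign leaves `sgn z`. If `τ` is an involution exchanging two cycles `z₁`, `z₂`
of equal length, conjugation by a lift of `τ` interchanges lifts `a`, `b` of the cycles, so the sign
is the one in `ab = ±ba`, which is `sgn z₁`. Both values are `-1` exactly for even length.

Cycles and such exchanges generate the centralizer, so `superSign σ` is the character `cycleSign σ`
(`superSignHom_eq`). All this happens in `{±1}`; only the result is mapped to `𝕜ˣ`, so the
characteristic plays no role. The spin superrepresentation is a line with the same character, and
its parity is found by evaluating at `τ = σ`. -/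

namespace SchurCover

variable {n : ℕ}

/-- The central generator `ζ`. -/
def zeta (n : ℕ) : SchurCover n := PresentedGroup.of .zeta

/-- The generator `sᵢ`. -/
def s (i : Fin (n - 1)) : SchurCover n := PresentedGroup.of (.s i)

theorem mk_eq_one {r : FreeGroup (SchurGen n)} (h : SchurRel n r) :
    PresentedGroup.mk {r | SchurRel n r} r = 1 :=
  PresentedGroup.one_of_mem h

theorem zeta_mul_zeta : zeta n * zeta n = 1 :=
  mk_eq_one SchurRel.zeta_sq

theorem zeta_mul_s (i : Fin (n - 1)) : zeta n * s i = s i * zeta n :=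
  mul_inv_eq_one.1 (mk_eq_one (SchurRel.zeta_comm i))

theorem s_mul_s (i : Fin (n - 1)) : s i * s i = zeta n :=
  mul_inv_eq_one.1 (mk_eq_one (SchurRel.s_sq i))

theorem braid {i j : Fin (n - 1)} (h : (i : ℕ) + 1 = j) : s i * s j * s i = s j * s i * s j :=
  mul_inv_eq_one.1 (mk_eq_one (SchurRel.braid i j h))

theorem s_mul_s_of_far {i j : Fin (n - 1)} (h : (i : ℕ) + 2 ≤ j ∨ (j : ℕ) + 2 ≤ i) :
    s i * s j = zeta n * s j * s i :=
  mul_inv_eq_one.1 (mk_eq_one (SchurRel.far i j h))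

@[simp]
theorem schurProj_zeta : schurProj n (zeta n) = 1 :=
  PresentedGroup.toGroup.of _

@[simp]
theorem schurProj_s (i : Fin (n - 1)) : schurProj n (s i) = adjSwap n i :=
  PresentedGroup.toGroup.of _

theorem zeta_comm (g : SchurCover n) : zeta n * g = g * zeta n := by
  have hg : g ∈ Subgroup.closure (Set.range (PresentedGroup.of (rels := {r | SchurRel n r}))) := by
    rw [PresentedGroup.closure_range_of]; trivial
  induction hg using Subgroup.closure_induction with
  | mem x hx =>
    obtain ⟨_ | i, rfl⟩ := hx
    · rfl
    · exact zeta_mul_s i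
  | one => simp
  | mul x y _ _ hx hy => rw [← mul_assoc, hx, mul_assoc, hy, mul_assoc]
  | inv x _ hx => exact (Commute.inv_right (show Commute (zeta n) x from hx)).eq

/-- The homomorphism `{±1} → S̃ₙ`, `-1 ↦ ζ`. -/
def zetaHom (n : ℕ) : ℤˣ →* SchurCover n where
  toFun u := if u = 1 then 1 else zeta n
  map_one' := by simp
  map_mul' u v := by
    rcases Int.units_eq_one_or u with rfl | rfl <;> rcases Int.units_eq_one_or v with rfl | rfl <;>
      simp [zeta_mul_zeta]

@[simp]
theorem zetaHom_neg_one : zetaHom n (-1) = zeta n := by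
  simp [zetaHom]

theorem zetaHom_comm (u : ℤˣ) (g : SchurCover n) : zetaHom n u * g = g * zetaHom n u := by
  rcases Int.units_eq_one_or u with rfl | rfl
  · simp
  · simpa using zeta_comm g

/-! ### The kernel of the projection -/

/-- The subgroup generated by `ζ` and `s₀, …, sₖ₋₁`. -/
def parabolic (n k : ℕ) : Subgroup (SchurCover n) :=
  Subgroup.closure ({zeta n} ∪ {x | ∃ i : Fin (n - 1), (i : ℕ) < k ∧ x = s i})

theorem zeta_mem_parabolic (k : ℕ) : zeta n ∈ parabolic n k :=
  Subgroup.subset_closure (Or.inl rfl)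

theorem s_mem_parabolic {k : ℕ} {i : Fin (n - 1)} (h : (i : ℕ) < k) : s i ∈ parabolic n k :=
  Subgroup.subset_closure (Or.inr ⟨i, h, rfl⟩)

theorem zetaHom_mem_parabolic (u : ℤˣ) (k : ℕ) : zetaHom n u ∈ parabolic n k := by
  rcases Int.units_eq_one_or u with rfl | rfl
  · simp
  · simpa using zeta_mem_parabolic k

theorem parabolic_mono {k m : ℕ} (h : k ≤ m) : parabolic n k ≤ parabolic n m := by
  refine Subgroup.closure_mono (Set.union_subset_union_right _ ?_)
  rintro x ⟨i, hi, rfl⟩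
  exact ⟨i, hi.trans_le h, rfl⟩

theorem parabolic_top : parabolic n (n - 1) = ⊤ := by
  rw [eq_top_iff, ← PresentedGroup.closure_range_of, parabolic]
  refine Subgroup.closure_mono ?_
  rintro _ ⟨_ | i, rfl⟩
  · exact Or.inl rfl
  · exact Or.inr ⟨i, i.2, rfl⟩

theorem exists_zetaHom_of_mem_parabolic_zero {x : SchurCover n} (hx : x ∈ parabolic n 0) :
    ∃ u, x = zetaHom n u := by
  have hle : parabolic n 0 ≤ (zetaHom n).range := by
    refine (Subgroup.closure_le _).2 ?_
    rintro x (rfl | ⟨i, hi, rfl⟩)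
    · exact ⟨-1, by simp⟩
    · exact absurd hi (Nat.not_lt_zero _)
  obtain ⟨u, hu⟩ := hle hx
  exact ⟨u, hu.symm⟩

/-- `s i` is far from every generator `s j` with `j < k`, so it passes each of them at the cost of
one `ζ`, and these signs accumulate in `u`. -/
theorem s_mul_mem_parabolic_comm {k : ℕ} {i : Fin (n - 1)} (h : ∀ j < k, j + 2 ≤ (i : ℕ))
    {x : SchurCover n} (hx : x ∈ parabolic n k) : ∃ u, s i * x = zetaHom n u * x * s i := by
  induction hx using Subgroup.closure_induction with
  | mem x hx =>
    rcases hx with rfl | ⟨j, hj, rfl⟩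
    · exact ⟨1, by simp [zeta_comm]⟩
    · exact ⟨-1, by simpa using s_mul_s_of_far (Or.inr (h _ hj))⟩
  | one => exact ⟨1, by simp⟩
  | mul x y _ _ hx hy =>
    obtain ⟨u, hu⟩ := hx
    obtain ⟨v, hv⟩ := hy
    refine ⟨u * v, ?_⟩
    rw [← mul_assoc, hu, mul_assoc _ _ y, hv, map_mul]
    simp only [← mul_assoc]
    rw [mul_assoc (zetaHom n u) x, ← zetaHom_comm v x, ← mul_assoc]
  | inv x _ hx =>
    obtain ⟨u, hu⟩ := hx
    refine ⟨u⁻¹, ?_⟩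
    rw [mul_assoc, map_inv, eq_inv_mul_iff_mul_eq, eq_inv_mul_iff_mul_eq, ← mul_assoc, ← mul_assoc,
      ← zetaHom_comm, ← hu, mul_inv_cancel_right]

theorem s_inv (i : Fin (n - 1)) : (s i)⁻¹ = s i * zeta n := by
  rw [inv_eq_iff_mul_eq_one, ← mul_assoc, s_mul_s, zeta_mul_zeta]

/-- The union of the double cosets of `1` and `sₖ` with respect to `⟨ζ, s₀, …, sₖ₋₁⟩`. -/
def doubleCosets (k : ℕ) (hk : k < n - 1) : Set (SchurCover n) :=
  {x | x ∈ parabolic n k ∨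
    ∃ a ∈ parabolic n k, ∃ b ∈ parabolic n k, x = a * s ⟨k, hk⟩ * b}

theorem mul_mem_doubleCosets {k : ℕ} {hk : k < n - 1} {a x : SchurCover n}
    (ha : a ∈ parabolic n k) (hx : x ∈ doubleCosets k hk) : a * x ∈ doubleCosets k hk := by
  rcases hx with hx | ⟨c, hc, d, hd, rfl⟩
  · exact Or.inl (mul_mem ha hx)
  · exact Or.inr ⟨a * c, mul_mem ha hc, d, hd, by simp only [mul_assoc]⟩

theorem doubleCosets_mul_mem {k : ℕ} {hk : k < n - 1} {a x : SchurCover n}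
    (ha : a ∈ parabolic n k) (hx : x ∈ doubleCosets k hk) : x * a ∈ doubleCosets k hk := by
  rcases hx with hx | ⟨c, hc, d, hd, rfl⟩
  · exact Or.inl (mul_mem hx ha)
  · exact Or.inr ⟨c, hc, d * a, mul_mem hd ha, by simp only [mul_assoc]⟩

/-- The union of the two double cosets contains `1` and is stable under `parabolic n k` on both
sides. Only stability under right multiplication by `sₖ` is in question, and on `a * sₖ * b` it
amounts to the hypothesis on `sₖ * b * sₖ`. -/
theorem parabolic_succ_subset_of_conj {k : ℕ} (hk : k < n - 1)
    (h : ∀ b ∈ parabolic n k, s ⟨k, hk⟩ * b * s ⟨k, hk⟩ ∈ doubleCosets k hk) :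
    (parabolic n (k + 1) : Set (SchurCover n)) ⊆ doubleCosets k hk := by
  have hs : ∀ (x : SchurCover n) (i : Fin (n - 1)), (i : ℕ) < k + 1 → x ∈ doubleCosets k hk →
      x * s i ∈ doubleCosets k hk := by
    intro x i hi hx
    rcases Nat.lt_succ_iff_lt_or_eq.1 hi with hi | hi
    · exact doubleCosets_mul_mem (s_mem_parabolic hi) hx
    · obtain rfl : i = ⟨k, hk⟩ := Fin.ext hi
      rcases hx with hx | ⟨c, hc, d, hd, rfl⟩
      · exact Or.inr ⟨x, hx, 1, one_mem _, by simp⟩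
      · have := mul_mem_doubleCosets hc (h d hd)
        simpa only [mul_assoc] using this
  intro x hx
  induction hx using Subgroup.closure_induction_right with
  | one => exact Or.inl (one_mem _)
  | mul_right x _ y hy hx =>
    rcases hy with rfl | ⟨i, hi, rfl⟩
    · exact doubleCosets_mul_mem (zeta_mem_parabolic k) hx
    · exact hs x i hi hx
  | mul_inv_cancel x _ y hy hx =>
    rcases hy with rfl | ⟨i, hi, rfl⟩
    · exact doubleCosets_mul_mem (inv_mem (zeta_mem_parabolic k)) hx
    · rw [s_inv, ← mul_assoc]
      exact doubleCosets_mul_mem (zeta_mem_parabolic k) (hs x i hi hx)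

/-- `sₖ` passes `b` up to a sign, and then `sₖ² = ζ` removes it. -/
theorem s_conj_mem_doubleCosets {k m : ℕ} (hk : k < n - 1) (hm : ∀ j < m, j + 2 ≤ k) (hmk : m ≤ k)
    {b : SchurCover n} (hb : b ∈ parabolic n m) :
    s ⟨k, hk⟩ * b * s ⟨k, hk⟩ ∈ doubleCosets k hk := by
  obtain ⟨u, hu⟩ := s_mul_mem_parabolic_comm (i := ⟨k, hk⟩) hm hb
  rw [hu, mul_assoc, s_mul_s]
  exact Or.inl (mul_mem (mul_mem (zetaHom_mem_parabolic u k) (parabolic_mono hmk hb))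
    (zeta_mem_parabolic k))

/-- The Coxeter argument, up to signs: by induction the middle factor is either far from `sₖ₊₁` or
of the form `c * sₖ * d` with `c`, `d` far from it. In the latter case the braid relation rewrites
`sₖ₊₁ sₖ sₖ₊₁` with a single `sₖ₊₁`. -/
theorem parabolic_succ_subset (k : ℕ) (hk : k < n - 1) :
    (parabolic n (k + 1) : Set (SchurCover n)) ⊆ doubleCosets k hk := by
  induction k with
  | zero =>
    exact parabolic_succ_subset_of_conj hk fun b hb =>
      s_conj_mem_doubleCosets hk (by simp) le_rfl hb
  | succ k ih =>
    have hk' : k < n - 1 := by omega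
    refine parabolic_succ_subset_of_conj hk fun b hb => ?_
    rcases ih hk' hb with hb | ⟨c, hc, d, hd, rfl⟩
    · exact s_conj_mem_doubleCosets hk (by omega) (Nat.le_succ k) hb
    · obtain ⟨u, hu⟩ := s_mul_mem_parabolic_comm (i := ⟨k + 1, hk⟩) (by simp) hc
      obtain ⟨v, hv⟩ := s_mul_mem_parabolic_comm (i := ⟨k + 1, hk⟩) (by simp) hd
      have hbr : s ⟨k + 1, hk⟩ * s ⟨k, hk'⟩ * s ⟨k + 1, hk⟩ =
          s ⟨k, hk'⟩ * s ⟨k + 1, hk⟩ * s ⟨k, hk'⟩ := (braid (by simp)).symm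
      have hd' : d * s ⟨k + 1, hk⟩ = zetaHom n v⁻¹ * s ⟨k + 1, hk⟩ * d := by
        rw [mul_assoc, hv, ← mul_assoc, ← mul_assoc, ← map_mul, inv_mul_cancel, map_one, one_mul]
      have hle := parabolic_mono (n := n) (Nat.le_succ k)
      have hsk : s ⟨k, hk'⟩ ∈ parabolic n (k + 1) := s_mem_parabolic (Nat.lt_succ_self k)
      refine Or.inr ⟨zetaHom n u * c * zetaHom n v⁻¹ * s ⟨k, hk'⟩, ?_, s ⟨k, hk'⟩ * d, ?_, ?_⟩
      · exact mul_mem (mul_mem (mul_mem (zetaHom_mem_parabolic _ _) (hle hc))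
          (zetaHom_mem_parabolic _ _)) hsk
      · exact mul_mem hsk (hle hd)
      · calc s ⟨k + 1, hk⟩ * (c * s ⟨k, hk'⟩ * d) * s ⟨k + 1, hk⟩
            = s ⟨k + 1, hk⟩ * c * (s ⟨k, hk'⟩ * (d * s ⟨k + 1, hk⟩)) := by
              simp only [mul_assoc]
          _ = zetaHom n u * c * s ⟨k + 1, hk⟩ *
              ((s ⟨k, hk'⟩ * zetaHom n v⁻¹) * s ⟨k + 1, hk⟩ * d) := by
              rw [hu, hd']; simp only [mul_assoc]
          _ = zetaHom n u * c * (s ⟨k + 1, hk⟩ * zetaHom n v⁻¹) *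
              (s ⟨k, hk'⟩ * s ⟨k + 1, hk⟩ * d) := by
              rw [← zetaHom_comm]; simp only [mul_assoc]
          _ = zetaHom n u * c * zetaHom n v⁻¹ *
              (s ⟨k + 1, hk⟩ * s ⟨k, hk'⟩ * s ⟨k + 1, hk⟩) * d := by
              rw [← zetaHom_comm]; simp only [mul_assoc]
          _ = _ := by rw [hbr]; simp only [mul_assoc]

theorem schurProj_apply_of_mem_parabolic {k : ℕ} {x : SchurCover n} (hx : x ∈ parabolic n k)
    (a : Fin n) (ha : k < (a : ℕ)) : schurProj n x a = a := by
  have hle : parabolic n k ≤ (MulAction.stabilizer (Equiv.Perm (Fin n)) a).comap (schurProj n) := by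
    refine (Subgroup.closure_le _).2 ?_
    rintro x (rfl | ⟨i, hi, rfl⟩)
    · simp
    · simp only [SetLike.mem_coe, Subgroup.mem_comap, schurProj_s, MulAction.mem_stabilizer_iff,
        Equiv.Perm.smul_def, adjSwap]
      apply Equiv.swap_apply_of_ne_of_ne <;> simp only [ne_eq, Fin.ext_iff] <;> omega
  exact hle hx

/-- Descent on `k`: an element of the double coset of `sₖ` cannot lie over `1`, since then the
transposition `(k, k + 1)` would be in the image of `parabolic n k`, which fixes the letter `k + 1`.
-/
theorem exists_zetaHom_of_schurProj_eq_one {x : SchurCover n} (hx : schurProj n x = 1) :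
    ∃ u, x = zetaHom n u := by
  suffices H : ∀ k ≤ n - 1, ∀ x ∈ parabolic n k, schurProj n x = 1 → ∃ u, x = zetaHom n u from
    H _ le_rfl x (by rw [parabolic_top]; trivial) hx
  clear hx x
  intro k
  induction k with
  | zero => exact fun _ x hx _ => exists_zetaHom_of_mem_parabolic_zero hx
  | succ k ih =>
    intro hk x hx h1
    rcases parabolic_succ_subset k hk hx with hx | ⟨a, ha, b, hb, rfl⟩
    · exact ih (by omega) x hx h1
    · exfalso
      have hs : schurProj n (s ⟨k, hk⟩) = schurProj n (a⁻¹ * b⁻¹) := by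
        simp only [map_mul, map_inv] at h1 ⊢
        rw [mul_assoc] at h1
        rw [eq_mul_inv_iff_mul_eq, eq_inv_iff_mul_eq_one, mul_eq_one_iff_eq_inv, ← inv_eq_iff_eq_inv]
        exact (eq_inv_of_mul_eq_one_right h1).symm ▸ rfl
      have h2 := schurProj_apply_of_mem_parabolic (mul_mem (inv_mem ha) (inv_mem hb))
        ⟨k + 1, by omega⟩ (by simp)
      rw [← hs, schurProj_s, adjSwap, Equiv.swap_apply_right] at h2
      simp [Fin.ext_iff] at h2

/-! ### Non-triviality of `ζ` -/

/-- The negative definite quadratic form on `ℝⁿ`. -/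
noncomputable def negForm (n : ℕ) : QuadraticForm ℝ (Fin n → ℝ) :=
  QuadraticMap.weightedSumSquares ℝ fun _ => (-1 : ℝ)

theorem polar_negForm (x y : Fin n → ℝ) :
    QuadraticMap.polar (negForm n) x y = -2 * (x ⬝ᵥ y) := by
  simp only [QuadraticMap.polar, negForm, QuadraticMap.weightedSumSquares_apply, dotProduct,
    Finset.mul_sum, ← Finset.sum_sub_distrib]
  refine Finset.sum_congr rfl fun i _ => ?_
  simp only [Pi.add_apply, smul_eq_mul]
  ring

theorem negForm_apply (x : Fin n → ℝ) : negForm n x = -(x ⬝ᵥ x) := by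
  simp only [negForm, QuadraticMap.weightedSumSquares_apply, dotProduct, ← Finset.sum_neg_distrib]
  simp

/-- The normalized root of the reflection `(i, i + 1)`. -/
noncomputable def root (i : Fin (n - 1)) : Fin n → ℝ :=
  (√2)⁻¹ • (Pi.single ⟨i, by omega⟩ 1 - Pi.single ⟨i + 1, by omega⟩ 1)

/-- With the factor `(√2)⁻¹` the roots have length one, so they square to `-1` in the Clifford
algebra of `negForm`, as `sᵢ² = ζ` requires. The values `-1 / 2` and `0` serve the braid and the far
relation. -/
theorem root_dotProduct (i j : Fin (n - 1)) : root i ⬝ᵥ root j =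
    if i = j then 1 else if (i : ℕ) + 1 = j ∨ (j : ℕ) + 1 = i then -1 / 2 else 0 := by
  have h2 : (√2)⁻¹ * (√2)⁻¹ = (1 / 2 : ℝ) := by
    rw [← mul_inv, Real.mul_self_sqrt zero_le_two, one_div]
  rw [root, root, smul_dotProduct, dotProduct_smul, smul_smul, h2]
  simp only [smul_eq_mul, sub_dotProduct, dotProduct_sub, single_dotProduct, Pi.single_apply, Fin.ext_iff]
  split_ifs <;> first | omega | norm_num

open CliffordAlgebra in
theorem ι_root_mul_self (i : Fin (n - 1)) :
    ι (negForm n) (root i) * ι (negForm n) (root i) = -1 := by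
  rw [ι_sq_scalar, negForm_apply, root_dotProduct]; simp

/-- The images of the generators in the Clifford algebra. -/
noncomputable def toClifford : SchurGen n → (CliffordAlgebra (negForm n))ˣ
  | .zeta => -1
  | .s i => ⟨CliffordAlgebra.ι _ (root i), -CliffordAlgebra.ι _ (root i),
      by rw [mul_neg, ι_root_mul_self, neg_neg], by rw [neg_mul, ι_root_mul_self, neg_neg]⟩

-- Orthogonal roots anticommute. Neighbouring roots satisfy `xy + yx = 1` and `x² = y² = -1`, so
-- both sides of the braid relation equal `x + y`.
open CliffordAlgebra in
theorem lift_toClifford :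
    ∀ r ∈ {r | SchurRel n r}, FreeGroup.lift (toClifford (n := n)) r = 1 := by
  have hadd : ∀ i j : Fin (n - 1), ι (negForm n) (root i) * ι (negForm n) (root j) +
      ι (negForm n) (root j) * ι (negForm n) (root i) =
        algebraMap ℝ _ (-2 * (root i ⬝ᵥ root j)) := fun i j => by
    rw [ι_mul_ι_add_swap, polar_negForm]
  rintro r (_ | i | i | ⟨i, j, h⟩ | ⟨i, j, h⟩)
  · simp [toClifford]
  · simp only [map_mul, map_inv, FreeGroup.lift_apply_of, mul_inv_eq_one, toClifford]
    ext
    simp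
  · simp only [map_mul, map_inv, FreeGroup.lift_apply_of, mul_inv_eq_one, toClifford]
    ext
    simpa using ι_root_mul_self i
  · simp only [map_mul, map_inv, FreeGroup.lift_apply_of, mul_inv_eq_one, toClifford]
    ext
    have hij := hadd i j
    rw [root_dotProduct, if_neg (by simp [Fin.ext_iff]; omega), if_pos (Or.inl h)] at hij
    have hij' : ι (negForm n) (root i) * ι (negForm n) (root j) =
        1 - ι (negForm n) (root j) * ι (negForm n) (root i) := by
      rw [eq_sub_iff_add_eq, hij]; norm_num
    have hii := ι_root_mul_self i
    have hjj := ι_root_mul_self j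
    simp only [Units.val_mul]
    generalize ι (negForm n) (root i) = x at *
    generalize ι (negForm n) (root j) = y at *
    calc x * y * x = (1 - y * x) * x := by rw [hij']
      _ = x - y * (x * x) := by noncomm_ring
      _ = y - (y * y) * x := by rw [hii, hjj]; noncomm_ring
      _ = y * (1 - y * x) := by noncomm_ring
      _ = y * x * y := by rw [← hij', mul_assoc]
  · simp only [map_mul, map_inv, FreeGroup.lift_apply_of, mul_inv_eq_one, toClifford]
    ext
    have hij := hadd i j
    rw [root_dotProduct, if_neg (by simp [Fin.ext_iff]; omega), if_neg (by omega)] at hij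
    have : ι (negForm n) (root i) * ι (negForm n) (root j) =
        -(ι (negForm n) (root j) * ι (negForm n) (root i)) := by
      rw [eq_neg_iff_add_eq_zero, hij]; simp
    simpa using this

theorem zeta_ne_one : zeta n ≠ 1 := by
  intro h
  have h1 : PresentedGroup.toGroup lift_toClifford (zeta n) = -1 := PresentedGroup.toGroup.of _
  rw [h, map_one] at h1
  have h2 : (1 : CliffordAlgebra (negForm n)) = -1 := congrArg Units.val h1
  have h3 : algebraMap ℝ (CliffordAlgebra (negForm n)) 2 = 0 := by
    rw [map_ofNat, ← one_add_one_eq_two]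
    nth_rewrite 2 [h2]
    exact add_neg_cancel 1
  -- This makes the Clifford algebra nontrivial, hence the structure map from the field injective.
  have : Invertible (2 : ℝ) := invertibleOfNonzero two_ne_zero
  rw [map_eq_zero_iff _ (algebraMap ℝ (CliffordAlgebra (negForm n))).injective] at h3
  exact two_ne_zero h3

theorem zetaHom_injective : Function.Injective (zetaHom n) := by
  rw [injective_iff_map_eq_one]
  intro u hu
  rcases Int.units_eq_one_or u with rfl | rfl
  · rfl
  · exact absurd (by simpa using hu) zeta_ne_one

end SchurCover

/-! ### The commutator pairing -/

open SchurCover Equiv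

section

variable {n : ℕ}

/-- The sign by which lifts of `σ` and `τ` to the double cover commute. -/
noncomputable def commSign (σ τ : Perm (Fin n)) : ℤˣ :=
  open Classical in
  if Commute (Function.surjInv (schurProj_surjective n) σ)
    (Function.surjInv (schurProj_surjective n) τ) then 1 else -1

theorem commSign_symm (σ τ : Perm (Fin n)) : commSign σ τ = commSign τ σ := by
  simp only [commSign]
  congr 1
  exact propext ⟨Commute.symm, Commute.symm⟩

theorem exists_zetaHom_mul {g h : SchurCover n} (hgh : schurProj n g = schurProj n h) :
    ∃ u, g = zetaHom n u * h := by
  obtain ⟨u, hu⟩ := exists_zetaHom_of_schurProj_eq_one (x := g * h⁻¹) (by simp [hgh])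
  exact ⟨u, by rw [← hu, inv_mul_cancel_right]⟩

/-- Two lifts of the same permutation differ by a central factor, which enters both products alike;
so the sign found for the chosen lifts is valid for all. -/
theorem mul_eq_commSign_mul {g h : SchurCover n}
    (hgh : Commute (schurProj n g) (schurProj n h)) :
    g * h = zetaHom n (commSign (schurProj n g) (schurProj n h)) * (h * g) := by
  have hl := Function.surjInv_eq (schurProj_surjective n)
  set l := Function.surjInv (schurProj_surjective n) with hldef
  have key : ∀ σ τ : Perm (Fin n), Commute σ τ →
      l σ * l τ = zetaHom n (commSign σ τ) * (l τ * l σ) := by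
    intro σ τ hστ
    obtain ⟨u, hu⟩ := exists_zetaHom_mul (g := l σ * l τ) (h := l τ * l σ) (by
      rw [map_mul, map_mul, hl, hl, hστ.eq])
    rcases Int.units_eq_one_or u with rfl | rfl
    · have hc : Commute (l σ) (l τ) := by simpa [Commute, SemiconjBy] using hu
      rw [commSign, if_pos hc, hu]
    · rw [commSign, if_neg, hu]
      intro hc
      rw [← hldef] at hc
      rw [hc.eq, right_eq_mul, map_eq_one_iff _ zetaHom_injective] at hu
      simp at hu
  obtain ⟨u, hu⟩ := exists_zetaHom_mul (g := g) (h := l (schurProj n g)) (hl _).symm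
  obtain ⟨v, hv⟩ := exists_zetaHom_mul (g := h) (h := l (schurProj n h)) (hl _).symm
  have := key _ _ hgh
  generalize commSign (schurProj n g) (schurProj n h) = w at *
  generalize l (schurProj n g) = x at *
  generalize l (schurProj n h) = y at *
  subst hu hv
  calc zetaHom n u * x * (zetaHom n v * y) = zetaHom n u * (x * zetaHom n v) * y := by
        simp only [mul_assoc]
    _ = zetaHom n u * zetaHom n v * (x * y) := by rw [← zetaHom_comm]; simp only [mul_assoc]
    _ = zetaHom n w * ((zetaHom n u * zetaHom n v * y) * x) := by
        rw [this, ← mul_assoc, ← mul_assoc, ← zetaHom_comm]; simp only [mul_assoc]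
    _ = zetaHom n w * (zetaHom n v * y * (zetaHom n u * x)) := by
        rw [zetaHom_comm u (zetaHom n v), mul_assoc _ _ y, zetaHom_comm u y]
        simp only [mul_assoc]

theorem commSign_eq {σ τ : Perm (Fin n)} (hστ : Commute σ τ) {g h : SchurCover n}
    (hg : schurProj n g = σ) (hh : schurProj n h = τ) {u : ℤˣ}
    (hu : g * h = zetaHom n u * (h * g)) : commSign σ τ = u := by
  subst hg hh
  rw [mul_eq_commSign_mul hστ] at hu
  exact zetaHom_injective (mul_right_cancel hu)

theorem commSign_mul_right {σ τ τ' : Perm (Fin n)} (h : Commute σ τ) (h' : Commute σ τ') :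
    commSign σ (τ * τ') = commSign σ τ * commSign σ τ' := by
  obtain ⟨g, rfl⟩ := schurProj_surjective n σ
  obtain ⟨x, rfl⟩ := schurProj_surjective n τ
  obtain ⟨y, rfl⟩ := schurProj_surjective n τ'
  refine commSign_eq (h.mul_right h') rfl (map_mul _ x y) ?_
  rw [← mul_assoc, mul_eq_commSign_mul h, mul_assoc, mul_assoc, mul_eq_commSign_mul h', map_mul,
    ← mul_assoc x, ← zetaHom_comm]
  simp only [mul_assoc]

theorem commSign_one_right (σ : Perm (Fin n)) : commSign σ 1 = 1 := by
  have := commSign_mul_right (Commute.one_right σ) (Commute.one_right σ)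
  simpa using this

theorem commSign_mul_left {σ σ' τ : Perm (Fin n)} (h : Commute σ τ) (h' : Commute σ' τ) :
    commSign (σ * σ') τ = commSign σ τ * commSign σ' τ := by
  simp only [commSign_symm _ τ]
  exact commSign_mul_right h.symm h'.symm

theorem commSign_conj {σ τ : Perm (Fin n)} (h : Commute σ τ) (π : Perm (Fin n)) :
    commSign (π * σ * π⁻¹) (π * τ * π⁻¹) = commSign σ τ := by
  obtain ⟨g, rfl⟩ := schurProj_surjective n σ
  obtain ⟨x, rfl⟩ := schurProj_surjective n τ
  obtain ⟨p, rfl⟩ := schurProj_surjective n π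
  refine commSign_eq (g := p * g * p⁻¹) (h := p * x * p⁻¹) ?_ (by simp) (by simp) ?_
  · have := h.map (MulAut.conj (schurProj n p)).toMonoidHom
    simpa using this
  · calc p * g * p⁻¹ * (p * x * p⁻¹) = p * (g * x) * p⁻¹ := by group
      _ = (p * zetaHom n (commSign (schurProj n g) (schurProj n x))) * (x * g) * p⁻¹ := by
        rw [mul_eq_commSign_mul h]; simp only [mul_assoc]
      _ = _ := by rw [← zetaHom_comm]; group

/-- By 4-transitivity of `Sₙ` and conjugation invariance it suffices to treat `(0 1)` and `(2 3)`,
whose lifts `s₀` and `s₂` satisfy the far relation. -/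
theorem commSign_swap_swap {a b c d : Fin n} (h : [a, b, c, d].Nodup) :
    commSign (swap a b) (swap c d) = -1 := by
  have hn : 4 ≤ n := by simpa using h.length_le_card
  let x : Fin 4 ↪ Fin n := Fin.castLEEmb hn
  let y : Fin 4 ↪ Fin n := ⟨[a, b, c, d].get, List.nodup_iff_injective_get.1 h⟩
  have := Equiv.Perm.isMultiplyPretransitive (Fin n) 4
  obtain ⟨π, hπ⟩ := MulAction.exists_smul_eq (Perm (Fin n)) x y
  have hx : ∀ i, π (x i) = y i := fun i => DFunLike.congr_fun hπ i
  have hs : ∀ i j, swap (y i) (y j) = π * swap (x i) (x j) * π⁻¹ := fun i j => by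
    rw [← swap_apply_apply, hx, hx]
  have hx4 : (swap (x 0) (x 1)).Disjoint (swap (x 2) (x 3)) := by
    rw [Perm.disjoint_iff_disjoint_support, Perm.support_swap (by simp),
      Perm.support_swap (by simp)]
    simp [x]
  change commSign (swap (y 0) (y 1)) (swap (y 2) (y 3)) = -1
  rw [hs, hs, commSign_conj hx4.commute]
  refine commSign_eq hx4.commute (g := s ⟨0, by omega⟩) (h := s ⟨2, by omega⟩) ?_ ?_ ?_
  · rw [schurProj_s]; rfl
  · rw [schurProj_s]; rfl
  · rw [s_mul_s_of_far (Or.inl (by simp)), zetaHom_neg_one, mul_assoc]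

/-- The Koszul sign of two elements with signs `a` and `b`. -/
def koszulSign (a b : ℤˣ) : ℤˣ := if a = 1 then 1 else b

theorem koszulSign_mul_right : ∀ a b c, koszulSign a (b * c) = koszulSign a b * koszulSign a c := by
  decide

theorem koszulSign_mul_left : ∀ a b c, koszulSign (a * b) c = koszulSign a c * koszulSign b c := by
  decide

theorem koszulSign_self : ∀ a, koszulSign a a = a := by decide

@[simp]
theorem koszulSign_one_right : ∀ a, koszulSign a 1 = 1 := by decide

theorem koszulSign_neg_one_right : ∀ a, koszulSign a (-1) = a := by decide

/-! ### Lifts of disjoint permutations -/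

theorem disjoint_ofSubtype {p : Fin n → Prop} [DecidablePred p] (σ : Perm {x // p x})
    (τ : Perm {x // ¬p x}) : (Perm.ofSubtype σ).Disjoint (Perm.ofSubtype τ) := by
  intro x
  by_cases hx : p x
  · exact Or.inr (Perm.ofSubtype_apply_of_not_mem _ (not_not.2 hx))
  · exact Or.inl (Perm.ofSubtype_apply_of_not_mem _ hx)

/-- Both sides are multiplicative in each argument, so two inductions on products of transpositions
reduce to `commSign_swap_swap`. Working on complementary subtypes keeps all the transpositions of
one side disjoint from those of the other. -/
theorem commSign_ofSubtype {p : Fin n → Prop} [DecidablePred p] (σ : Perm {x // p x})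
    (τ : Perm {x // ¬p x}) : commSign (Perm.ofSubtype σ) (Perm.ofSubtype τ) =
      koszulSign (Perm.sign σ) (Perm.sign τ) := by
  induction τ using Perm.swap_induction_on with
  | one => rw [map_one, commSign_one_right, map_one, koszulSign_one_right]
  | swap_mul τ c d hcd ih =>
    rw [map_mul, commSign_mul_right (disjoint_ofSubtype _ _).commute
      (disjoint_ofSubtype _ _).commute, ih, map_mul, koszulSign_mul_right, Perm.sign_swap hcd,
      koszulSign_neg_one_right]
    congr 1
    clear ih τ
    induction σ using Perm.swap_induction_on with
    | one => rw [map_one, commSign_symm, commSign_one_right, map_one]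
    | swap_mul σ a b hab ih =>
      rw [map_mul, commSign_mul_left (disjoint_ofSubtype _ _).commute
        (disjoint_ofSubtype _ _).commute, ih, map_mul, Perm.sign_swap hab,
        Perm.ofSubtype_swap_eq, Perm.ofSubtype_swap_eq, commSign_swap_swap]
      have hpq : ∀ (x : {x // p x}) (y : {x // ¬p x}), (x : Fin n) ≠ y := fun x y h =>
        y.2 (h ▸ x.2)
      simp only [List.nodup_cons, List.mem_cons, List.not_mem_nil, or_false, not_or,
        not_false_eq_true, List.nodup_nil, and_true]
      exact ⟨⟨Subtype.coe_injective.ne hab, hpq _ _, hpq _ _⟩, ⟨hpq _ _, hpq _ _⟩,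
        Subtype.coe_injective.ne hcd⟩

theorem commSign_of_disjoint {σ τ : Perm (Fin n)} (h : σ.Disjoint τ) :
    commSign σ τ = koszulSign (Perm.sign σ) (Perm.sign τ) := by
  have h1 : Perm.ofSubtype (σ.subtypePerm (p := fun x => σ x ≠ x)
      (fun x => by simp [σ.injective.eq_iff])) = σ := Perm.ofSubtype_subtypePerm _ fun x hx => hx
  have h2 : Perm.ofSubtype (τ.subtypePerm (p := fun x => ¬σ x ≠ x)
      (fun x => by
        have hx := h x
        have hτx := h (τ x)
        rw [τ.injective.eq_iff] at hτx
        rcases eq_or_ne (τ x) x with he | he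
        · rw [he]
        · simp [hx.resolve_right he, hτx.resolve_right he])) = τ :=
    Perm.ofSubtype_subtypePerm _ fun x hx => not_not.2 ((h x).resolve_right hx)
  rw [← h1, ← h2, commSign_ofSubtype, Perm.sign_ofSubtype, Perm.sign_ofSubtype]

/-! ### The supersymbol as a sign -/

/-- The supersymbol of commuting permutations, as a sign. -/
noncomputable def superSign (σ τ : Perm (Fin n)) : ℤˣ :=
  koszulSign (Perm.sign σ) (Perm.sign τ) * commSign σ τ

theorem superSign_mul_right {σ τ τ' : Perm (Fin n)} (h : Commute σ τ) (h' : Commute σ τ') :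
    superSign σ (τ * τ') = superSign σ τ * superSign σ τ' := by
  rw [superSign, superSign, superSign, commSign_mul_right h h', map_mul, koszulSign_mul_right,
    mul_mul_mul_comm]

theorem superSign_mul_left {σ σ' τ : Perm (Fin n)} (h : Commute σ τ) (h' : Commute σ' τ) :
    superSign (σ * σ') τ = superSign σ τ * superSign σ' τ := by
  rw [superSign, superSign, superSign, commSign_mul_left h h', map_mul, koszulSign_mul_left,
    mul_mul_mul_comm]

theorem superSign_one_right (σ : Perm (Fin n)) : superSign σ 1 = 1 := by
  rw [superSign, commSign_one_right, map_one, koszulSign_one_right, one_mul]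

theorem superSign_of_disjoint {σ τ : Perm (Fin n)} (h : σ.Disjoint τ) : superSign σ τ = 1 := by
  rw [superSign, commSign_of_disjoint h, Int.units_mul_self]

theorem commSign_self (σ : Perm (Fin n)) : commSign σ σ = 1 := by
  obtain ⟨g, rfl⟩ := schurProj_surjective n σ
  exact commSign_eq (Commute.refl _) rfl rfl (by simp)

/-- On one of its disjoint factors `z`, the supersymbol of `z * σ` is the sign of `z`. -/
theorem superSign_mul_self {z σ : Perm (Fin n)} (h : z.Disjoint σ) :
    superSign (z * σ) z = Perm.sign z := by
  rw [superSign_mul_left (Commute.refl z) h.symm.commute, superSign_of_disjoint h.symm, superSign,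
    commSign_self, koszulSign_self, mul_one, mul_one]

/-- The supersymbol of `z₁ * z₂` and an involution exchanging the disjoint permutations `z₁` and
`z₂` is the sign of `z₁`. -/
theorem superSign_mul_of_conj {z₁ z₂ τ : Perm (Fin n)} (h : z₁.Disjoint z₂) (hτ : τ * τ = 1)
    (hz : τ * z₁ * τ⁻¹ = z₂) : superSign (z₁ * z₂) τ = Perm.sign z₁ := by
  have hsign : Perm.sign z₂ = Perm.sign z₁ := by
    rw [← hz, map_mul, map_mul, map_inv, mul_comm (Perm.sign τ), mul_inv_cancel_right]
  have hτi : τ⁻¹ = τ := inv_eq_of_mul_eq_one_right hτ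
  have hcomm : Commute (z₁ * z₂) τ := by
    have h21 : τ * z₂ * τ⁻¹ = z₁ := by
      rw [← hz, hτi]
      calc τ * (τ * z₁ * τ) * τ = (τ * τ) * z₁ * (τ * τ) := by simp only [mul_assoc]
        _ = z₁ := by rw [hτ, one_mul, mul_one]
    have : τ * (z₁ * z₂) * τ⁻¹ = z₁ * z₂ := by
      calc τ * (z₁ * z₂) * τ⁻¹ = (τ * z₁ * τ⁻¹) * (τ * z₂ * τ⁻¹) := by group
        _ = z₁ * z₂ := by rw [hz, h21, h.commute.eq]
    exact (mul_inv_eq_iff_eq_mul.1 this).symm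
  -- `z₁ * z₂` is even, so there is no Koszul sign and only `commSign` remains.
  rw [superSign, map_mul, hsign, Int.units_mul_self, koszulSign, if_pos rfl, one_mul]
  obtain ⟨t, rfl⟩ := schurProj_surjective n τ
  obtain ⟨a, rfl⟩ := schurProj_surjective n z₁
  have hb : schurProj n (t * a * t⁻¹) = z₂ := by rw [map_mul, map_mul, map_inv, hz]
  obtain ⟨u, hu⟩ := exists_zetaHom_of_schurProj_eq_one (x := t * t) (by rw [map_mul, hτ])
  refine commSign_eq (g := a * (t * a * t⁻¹)) hcomm (by rw [map_mul, hb]) rfl ?_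
  have hab : a * (t * a * t⁻¹) = zetaHom n (Perm.sign (schurProj n a)) * ((t * a * t⁻¹) * a) := by
    rw [mul_eq_commSign_mul (by rw [hb]; exact h.commute), hb, commSign_of_disjoint h, hsign,
      koszulSign_self]
  have htt : t * t * a = a * (t * t) := by rw [hu, zetaHom_comm]
  -- Since `t * t` commutes with `a`, conjugation by `t` interchanges the two lifts `a` and `t * a *
  -- t⁻¹`.
  have htab : t * (a * (t * a * t⁻¹)) = (t * a * t⁻¹) * a * t := by
    calc t * (a * (t * a * t⁻¹)) = t * a * t⁻¹ * (t * t * a) * t⁻¹ := by group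
      _ = t * a * t⁻¹ * a * t := by rw [htt]; group
  rw [htab, hab]
  simp only [mul_assoc]

/-! ### From signs to the supersymbol over `𝕜` -/

section

variable (𝕜 : Type u) [Field 𝕜]

/-- The homomorphism `{±1} → 𝕜ˣ`. -/
def signToUnits : ℤˣ →* 𝕜ˣ := Units.map (Int.castRingHom 𝕜).toMonoidHom

theorem signToUnits_neg_one : signToUnits 𝕜 (-1) = -1 := by
  ext; simp [signToUnits]

theorem neg_one_pow_permDeg (σ τ : Perm (Fin n)) :
    (-1 : 𝕜ˣ) ^ ((permDeg σ).val * (permDeg τ).val) =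
      signToUnits 𝕜 (koszulSign (Perm.sign σ) (Perm.sign τ)) := by
  rw [permDeg, permDeg]
  rcases Int.units_eq_one_or (Perm.sign σ) with h | h <;>
    rcases Int.units_eq_one_or (Perm.sign τ) with h' | h' <;>
    simp [h, h', koszulSign, signToUnits_neg_one, ZMod.val_one]

theorem schurCocycle_eq {l : Perm (Fin n) → SchurCover n} {σ τ : Perm (Fin n)} {u : ℤˣ}
    (hu : l (σ * τ) = zetaHom n u * (l σ * l τ)) :
    schurCocycle 𝕜 l σ τ = signToUnits 𝕜 u := by
  have : l (σ * τ) * (l τ)⁻¹ * (l σ)⁻¹ = zetaHom n u := by rw [hu]; group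
  rw [schurCocycle, this]
  rcases Int.units_eq_one_or u with rfl | rfl
  · simp
  · simp [signToUnits_neg_one, zeta_ne_one]

/-- As `σ * τ = τ * σ`, the two cocycle values compare the same lift with `l σ * l τ` and with `l τ
* l σ`; their quotient is the sign between these products, whatever the section. -/
theorem supersymbol_eq {l : Perm (Fin n) → SchurCover n} (hl : ∀ τ, schurProj n (l τ) = τ)
    {σ τ : Perm (Fin n)} (h : Commute σ τ) :
    supersymbol permDeg (schurCocycle 𝕜 l) σ τ = signToUnits 𝕜 (superSign σ τ) := by
  obtain ⟨u, hu⟩ := exists_zetaHom_mul (g := l (σ * τ)) (h := l σ * l τ) (by simp [hl])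
  obtain ⟨v, hv⟩ := exists_zetaHom_mul (g := l (τ * σ)) (h := l τ * l σ) (by simp [hl])
  rw [supersymbol, schurCocycle_eq 𝕜 hu, schurCocycle_eq 𝕜 hv, neg_one_pow_permDeg,
    superSign, map_mul, ← map_div]
  congr 2
  refine (commSign_eq h (hl σ) (hl τ) ?_).symm
  rw [h.eq, hv] at hu
  rw [div_eq_mul_inv, Int.units_inv_eq_self, ← Int.units_inv_eq_self u,
    map_mul, mul_assoc, hu, ← mul_assoc, ← map_mul, inv_mul_cancel, map_one, one_mul]

end

/-! ### Existence of labellings -/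

theorem Equiv.Perm.zpow_apply_eq_iff_of_period {α : Type*} {σ : Perm α} {x : α} {k : ℕ}
    (h : MulAction.period σ x = k) (p q : ℤ) :
    (σ ^ p) x = (σ ^ q) x ↔ (p : ZMod k) = q := by
  have h1 : (σ ^ p) x = (σ ^ q) x ↔ σ ^ (p - q) • x = x := by
    rw [zpow_sub, ← (Commute.zpow_zpow_self σ q p).inv_left.eq, mul_smul, inv_smul_eq_iff]
    rfl
  rw [h1, MulAction.zpow_smul_eq_iff_period_dvd, h, ← ZMod.intCast_zmod_eq_zero_iff_dvd]
  rw [Int.cast_sub, sub_eq_zero]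

theorem Equiv.Perm.SameCycle.period_eq {α : Type*} {σ : Perm α} {x y : α}
    (h : σ.SameCycle x y) : MulAction.period σ x = MulAction.period σ y := by
  obtain ⟨i, rfl⟩ := h
  have key : ∀ m : ℕ, σ ^ m • (σ ^ i) x = (σ ^ i) x ↔ σ ^ m • x = x := fun m => by
    rw [Perm.smul_def, Perm.smul_def, ← Perm.mul_apply,
      ← zpow_natCast σ m, (Commute.zpow_zpow_self σ m i).eq, Perm.mul_apply, EmbeddingLike.apply_eq_iff_eq]
  refine Nat.dvd_antisymm ?_ ?_
  · rw [← MulAction.pow_smul_eq_iff_period_dvd, ← key, MulAction.pow_period_smul]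
  · rw [← MulAction.pow_smul_eq_iff_period_dvd, key, MulAction.pow_period_smul]

theorem Equiv.Perm.period_eq_card_support {α : Type*} [Fintype α] [DecidableEq α] {σ c : Perm α}
    (hc : c ∈ σ.cycleFactorsFinset) {x : α} (hx : x ∈ c.support) :
    MulAction.period σ x = c.support.card := by
  have hcx : c = σ.cycleOf x := Perm.cycle_is_cycleOf hx hc
  have hcyc : c.IsCycle := (Perm.mem_cycleFactorsFinset_iff.1 hc).1
  have key : ∀ m : ℕ, σ ^ m • x = x ↔ c.support.card ∣ m := fun m => by
    rw [← hcyc.orderOf, orderOf_dvd_iff_pow_eq_one, hcyc.pow_eq_one_iff' (Perm.mem_support.1 hx), hcx,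
      Perm.cycleOf_pow_apply_self, Perm.smul_def]
  refine Nat.dvd_antisymm ?_ ?_
  · rw [← MulAction.pow_smul_eq_iff_period_dvd, key]
  · rw [← key, MulAction.pow_period_smul]

/-- `cycleFactorsFinset` does not see fixed points, so `k = 1` is handled through the complement of
the support; for `k ≥ 2` a point is chosen in each cyclic factor of length `k`. -/
theorem exists_basePoints (σ : Perm (Fin n)) {k : ℕ} (hk : 1 ≤ k) :
    ∃ b : Fin (numCycles σ k) → Fin n, (∀ j, MulAction.period σ (b j) = k) ∧
      ∀ j j', σ.SameCycle (b j) (b j') → j = j' := by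
  rcases hk.eq_or_lt with rfl | hk
  · have hcard : (σ.supportᶜ).card = numCycles σ 1 := by
      have h1 : (1 : ℕ) ∉ σ.cycleType := fun h => absurd (Perm.one_lt_of_mem_cycleType h) (lt_irrefl _)
      rw [numCycles, Perm.parts_partition, Multiset.count_add, Multiset.count_eq_zero_of_notMem h1,
        Multiset.count_replicate_self, zero_add, Finset.card_compl]
    have hfix : ∀ j, σ ((σ.supportᶜ).orderEmbOfFin hcard j) = (σ.supportᶜ).orderEmbOfFin hcard j :=
      fun j => by
        simpa using Finset.mem_compl.1 ((σ.supportᶜ).orderEmbOfFin_mem hcard j)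
    refine ⟨(σ.supportᶜ).orderEmbOfFin hcard, fun j => ?_, fun j j' h => ?_⟩
    · rw [← Nat.dvd_one, ← MulAction.pow_smul_eq_iff_period_dvd, pow_one]
      exact hfix j
    · obtain ⟨i, hi⟩ := h
      rw [Perm.zpow_apply_eq_self_of_apply_eq_self (hfix j)] at hi
      exact ((σ.supportᶜ).orderEmbOfFin hcard).injective hi
  · have hcard : (σ.cycleFactorsFinset.filter fun c => k = c.support.card).card =
        numCycles σ k := by
      rw [numCycles, Perm.parts_partition, Multiset.count_add,
        Multiset.count_replicate, if_neg hk.ne, add_zero, Perm.cycleType_def, Multiset.count_map]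
      rfl
    let e := (Finset.equivFinOfCardEq hcard).symm
    have hmem : ∀ j, (e j).1 ∈ σ.cycleFactorsFinset := fun j => (Finset.mem_filter.1 (e j).2).1
    have hsupp : ∀ j, k = (e j).1.support.card := fun j => (Finset.mem_filter.1 (e j).2).2
    have hne : ∀ j, ∃ x, x ∈ (e j).1.support := fun j =>
      Finset.card_pos.1 (by rw [← hsupp j]; omega)
    choose b hb using hne
    refine ⟨b, fun j => ?_, fun j j' h => ?_⟩
    · rw [Perm.period_eq_card_support (hmem j) (hb j), ← hsupp j]
    · have := h.cycleOf_eq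
      rw [← Perm.cycle_is_cycleOf (hb j) (hmem j), ← Perm.cycle_is_cycleOf (hb j') (hmem j')] at this
      exact e.injective (Subtype.ext this)

theorem sum_numCycles_mul (σ : Perm (Fin n)) :
    ∑ k : Finset.Icc 1 n, numCycles σ k * (k : ℕ) = n := by
  rw [Finset.sum_coe_sort (Finset.Icc 1 n) fun k => numCycles σ k * k]
  have h := Finset.sum_multiset_count_of_subset σ.partition.parts (Finset.Icc 1 n) fun k hk => by
    rw [Multiset.mem_toFinset] at hk
    have h1 := σ.partition.le_of_mem_parts hk
    rw [Fintype.card_fin] at h1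
    exact Finset.mem_Icc.2 ⟨σ.partition.parts_pos hk, h1⟩
  simpa [numCycles, σ.partition.parts_sum] using h.symm

/-- The powers of `σ` carry the base points around their cycles. Injectivity comes from periods, and
bijectivity then follows from the count `∑ k N_k = n`. -/
theorem nonempty_cycleLabelling (σ : Perm (Fin n)) : Nonempty (CycleLabelling σ) := by
  have hk : ∀ k : Finset.Icc 1 n, 1 ≤ (k : ℕ) := fun k => (Finset.mem_Icc.1 k.2).1
  have hz : ∀ k : Finset.Icc 1 n, NeZero (k : ℕ) := fun k => ⟨by have := hk k; omega⟩
  choose b hb hinj using fun k : Finset.Icc 1 n => exists_basePoints σ (hk k)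
  let f : CycleSpace σ → Fin n := fun x => (σ ^ (x.2.2.cast : ℤ)) (b x.1 x.2.1)
  have hf : Function.Bijective f := by
    rw [Nat.bijective_iff_injective_and_card]
    constructor
    · rintro ⟨k, j, a⟩ ⟨k', j', a'⟩ h
      have hs : σ.SameCycle (b k j) (b k' j') := by
        have h1 : σ.SameCycle (b k j) (f ⟨k, j, a⟩) := ⟨_, rfl⟩
        have h2 : σ.SameCycle (b k' j') (f ⟨k', j', a'⟩) := ⟨_, rfl⟩
        rw [h] at h1
        exact h1.trans h2.symm
      have hkk := hs.period_eq
      rw [hb, hb] at hkk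
      obtain rfl : k = k' := Subtype.ext hkk
      obtain rfl := hinj _ _ _ hs
      have h3 := (Perm.zpow_apply_eq_iff_of_period (hb k j) _ _).1 h
      rw [ZMod.intCast_zmod_cast, ZMod.intCast_zmod_cast] at h3
      obtain rfl : a = a' := h3
      rfl
    · rw [Nat.card_sigma]
      simp only [Nat.card_prod, Nat.card_zmod, Nat.card_fin]
      exact sum_numCycles_mul σ
  refine ⟨⟨Equiv.ofBijective f hf, fun k j a => ?_⟩⟩
  change σ ((σ ^ (a.cast : ℤ)) (b k j)) = (σ ^ ((a + 1).cast : ℤ)) (b k j)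
  -- The integer representative of `a + 1` may wrap around, so the exponents are compared only
  -- modulo `k`.
  rw [← Perm.mul_apply, ← zpow_one_add, Perm.zpow_apply_eq_iff_of_period (hb k j)]
  push_cast
  rw [add_comm]

/-! ### The centralizer -/

namespace CycleLabelling

variable {σ : Perm (Fin n)} (φ : CycleLabelling σ)

theorem hom_apply (w : CycleGroup σ) (x : CycleSpace σ) :
    φ.hom w (φ.toEquiv x) = φ.toEquiv (cycleAct w x) := by
  change φ.toEquiv (cycleAct w (φ.toEquiv.symm (φ.toEquiv x))) = _
  rw [Equiv.symm_apply_apply]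

theorem perm_ext {τ τ' : Perm (Fin n)} (h : ∀ x, τ (φ.toEquiv x) = τ' (φ.toEquiv x)) : τ = τ' :=
  Equiv.ext fun y => by simpa using h (φ.toEquiv.symm y)

theorem pow_apply (k : Finset.Icc 1 n) (j : Fin (numCycles σ k)) (a : ZMod k) (m : ℕ) :
    (σ ^ m) (φ.toEquiv ⟨k, j, a⟩) = φ.toEquiv ⟨k, j, a + m⟩ := by
  induction m with
  | zero => simp
  | succ m ih => rw [pow_succ', Perm.mul_apply, ih, φ.map_succ]; push_cast; rw [add_assoc]

theorem pow_apply_eq_self_iff (k : Finset.Icc 1 n) (j : Fin (numCycles σ k)) (a : ZMod k) (m : ℕ) :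
    (σ ^ m) (φ.toEquiv ⟨k, j, a⟩) = φ.toEquiv ⟨k, j, a⟩ ↔ (k : ℕ) ∣ m := by
  rw [pow_apply, φ.toEquiv.apply_eq_iff_eq, ← ZMod.natCast_eq_zero_iff]
  simp

theorem commute_hom (w : CycleGroup σ) : Commute σ (φ.hom w) := by
  refine φ.perm_ext ?_
  rintro ⟨k, j, a⟩
  rw [Perm.mul_apply, Perm.mul_apply, φ.map_succ, hom_apply, hom_apply]
  simp only [cycleAct, Equiv.coe_fn_mk, φ.map_succ]
  rw [add_right_comm]

theorem hom_injective : Function.Injective φ.hom := by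
  intro w w' h
  have key : ∀ k j a, cycleAct w ⟨k, j, a⟩ = cycleAct w' ⟨k, j, a⟩ := fun k j a =>
    φ.toEquiv.injective (by rw [← hom_apply, ← hom_apply, h])
  have hr : ∀ k, (w k).right = (w' k).right := fun k => Equiv.ext fun j => by
    have := key k j 0
    simp only [cycleAct, Equiv.coe_fn_mk, Sigma.mk.injEq, heq_eq_eq, true_and, Prod.mk.injEq] at this
    exact this.1
  funext k
  refine SemidirectProduct.ext (funext fun i => ?_) (hr k)
  have := key k ((w k).right.symm i) 0
  simp only [cycleAct, Equiv.coe_fn_mk, Sigma.mk.injEq, heq_eq_eq, true_and, Prod.mk.injEq] at this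
  rw [← hr k, Equiv.apply_symm_apply] at this
  simpa using this.2

/-- Commuting with `σ` preserves periods, so `τ` maps `k`-cycles to `k`-cycles, and its value at a
base point determines it on the whole cycle. -/
theorem exists_hom_eq {τ : Perm (Fin n)} (h : Commute σ τ) : ∃ w, φ.hom w = τ := by
  have hcomm : ∀ (m : ℕ) x, (σ ^ m) (τ x) = τ ((σ ^ m) x) := fun m x => by
    rw [← Perm.mul_apply, (h.pow_left m).eq, Perm.mul_apply]
  have h0 : ∀ (k : Finset.Icc 1 n) (j : Fin (numCycles σ k)),
      ∃ (i : Fin (numCycles σ k)) (b : ZMod k), τ (φ.toEquiv ⟨k, j, 0⟩) = φ.toEquiv ⟨k, i, b⟩ := by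
    intro k j
    obtain ⟨⟨k', i, b⟩, hx⟩ := φ.toEquiv.surjective (τ (φ.toEquiv ⟨k, j, 0⟩))
    have key : ∀ m : ℕ, (k' : ℕ) ∣ m ↔ (k : ℕ) ∣ m := fun m => by
      rw [← φ.pow_apply_eq_self_iff k' i b, hx, hcomm, τ.apply_eq_iff_eq, φ.pow_apply_eq_self_iff]
    obtain rfl : k' = k := Subtype.ext (Nat.dvd_antisymm ((key _).2 dvd_rfl) ((key _).1 dvd_rfl))
    exact ⟨i, b, hx.symm⟩
  choose p f hpf using h0
  have hpfa : ∀ (k : Finset.Icc 1 n) (j : Fin (numCycles σ k)) (a : ZMod k),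
      τ (φ.toEquiv ⟨k, j, a⟩) = φ.toEquiv ⟨k, p k j, f k j + a⟩ := by
    intro k j a
    have : NeZero (k : ℕ) := ⟨by have := (Finset.mem_Icc.1 k.2).1; omega⟩
    have h1 := φ.pow_apply k j 0 a.val
    rw [zero_add, ZMod.natCast_zmod_val] at h1
    rw [← h1, ← hcomm, hpf, φ.pow_apply, ZMod.natCast_zmod_val]
  have hinj : ∀ k, Function.Injective (p k) := by
    intro k j j' hj
    have h1 : τ (φ.toEquiv ⟨k, j, 0⟩) = τ (φ.toEquiv ⟨k, j', f k j - f k j'⟩) := by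
      rw [hpfa, hpfa, hj]; simp
    have h2 := φ.toEquiv.injective (τ.injective h1)
    simp only [Sigma.mk.injEq, heq_eq_eq, true_and, Prod.mk.injEq] at h2
    exact h2.1
  let π : ∀ k : Finset.Icc 1 n, Perm (Fin (numCycles σ k)) := fun k =>
    Equiv.ofBijective (p k) (Finite.injective_iff_bijective.1 (hinj k))
  -- In `cycleAct` the shift is indexed by the target cycle, while `f` is indexed by the source;
  -- hence the inverse.
  refine ⟨fun k => ⟨fun i => Multiplicative.ofAdd (f k ((π k).symm i)), π k⟩, φ.perm_ext ?_⟩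
  rintro ⟨k, j, a⟩
  rw [hom_apply, hpfa]
  simp only [cycleAct, Equiv.coe_fn_mk, Equiv.symm_apply_apply, toAdd_ofAdd, add_comm a]
  rfl

/-- The isomorphism from `∏ₖ ℤ/k ≀ S_{N_k}` onto the centralizer of `σ`. -/
noncomputable def mulEquiv : CycleGroup σ ≃* Subgroup.centralizer {σ} :=
  MulEquiv.ofBijective
    (φ.hom.codRestrict (Subgroup.centralizer {σ}) fun w =>
      Subgroup.mem_centralizer_singleton_iff.2 (φ.commute_hom w).symm.eq)
    ⟨fun _ _ h => φ.hom_injective (congrArg Subtype.val h), fun τ => by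
      obtain ⟨w, hw⟩ := φ.exists_hom_eq
        (τ := τ) (Subgroup.mem_centralizer_singleton_iff.1 τ.2).symm
      exact ⟨w, Subtype.ext hw⟩⟩

theorem coe_mulEquiv (w : CycleGroup σ) : (φ.mulEquiv w : Perm (Fin n)) = φ.hom w :=
  rfl

end CycleLabelling

/-! ### The spin characters as signs -/

/-- The character `χ_spin` of `ℤ/k` with values in `{±1}`. -/
def spinSign (k : ℕ) (hk : Even k) : Multiplicative (ZMod k) →* ℤˣ where
  toFun a := (-1 : ℤˣ) ^ (ZMod.castHom hk.two_dvd (ZMod 2) a.toAdd)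
  map_one' := by simp
  map_mul' a b := by rw [toAdd_mul, map_add, uzpow_add]

theorem spinSign_ofAdd_one (k : ℕ) (hk : Even k) : spinSign k hk (Multiplicative.ofAdd 1) = -1 := by
  change (-1 : ℤˣ) ^ (ZMod.castHom hk.two_dvd (ZMod 2) 1) = -1
  rw [map_one, uzpow_one]

/-- The character `χ ≀ sgn` of a wreath product. -/
def wreathSign {H : Type} [Group H] (χ : H →* ℤˣ) (N : ℕ) : Wreath H N →* ℤˣ where
  toFun w := Perm.sign w.right * ∏ j, χ (w.left j)
  map_one' := by simp
  map_mul' w w' := by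
    have h : ∏ j, χ ((mulAutArrow w.right w'.left) j) = ∏ j, χ (w'.left j) :=
      Equiv.prod_comp (w.right⁻¹) fun j => χ (w'.left j)
    simp only [SemidirectProduct.mul_right, SemidirectProduct.mul_left, map_mul, Pi.mul_apply,
      Finset.prod_mul_distrib, h, mul_mul_mul_comm]

theorem wreathSign_apply {H : Type} [Group H] (χ : H →* ℤˣ) (N : ℕ) (w : Wreath H N) :
    wreathSign χ N w = Perm.sign w.right * ∏ j, χ (w.left j) :=
  rfl

/-- The character `⨂ χ_spin ≀ sgn`, over the even cycle lengths `k`. -/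
def cycleSign (σ : Perm (Fin n)) : CycleGroup σ →* ℤˣ where
  toFun w := ∏ k : {k : Finset.Icc 1 n // Even (k : ℕ)}, wreathSign (spinSign k.1 k.2) _ (w k.1)
  map_one' := by simp
  map_mul' w w' := by simp [Finset.prod_mul_distrib]

theorem cycleSign_apply (σ : Perm (Fin n)) (w : CycleGroup σ) : cycleSign σ w =
    ∏ k : {k : Finset.Icc 1 n // Even (k : ℕ)}, wreathSign (spinSign k.1 k.2) _ (w k.1) :=
  rfl

theorem cycleSign_mulSingle (σ : Perm (Fin n)) (k : Finset.Icc 1 n)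
    (w : Wreath (Multiplicative (ZMod k)) (numCycles σ k)) :
    cycleSign σ (Pi.mulSingle k w) =
      if hk : Even (k : ℕ) then wreathSign (spinSign k hk) _ w else 1 := by
  rw [cycleSign_apply]
  split_ifs with hk
  · rw [Fintype.prod_eq_single (⟨k, hk⟩ : {k : Finset.Icc 1 n // Even (k : ℕ)}), Pi.mulSingle_eq_same]
    intro k' hk'
    rw [Pi.mulSingle_eq_of_ne (fun h => hk' (Subtype.ext h)), map_one]
  · refine Finset.prod_eq_one fun k' _ => ?_
    rw [Pi.mulSingle_eq_of_ne (fun h => hk (by rw [← h]; exact k'.2)), map_one]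

/-! ### The supersymbol on generators of the centralizer -/

theorem sign_addRight_one (k : ℕ) [NeZero k] :
    Perm.sign (Equiv.addRight (1 : ZMod k)) = (-1) ^ (k - 1) := by
  obtain ⟨m, rfl⟩ := Nat.exists_eq_succ_of_ne_zero (NeZero.ne k)
  have h : Equiv.addRight (1 : ZMod (m + 1)) = finRotate (m + 1) :=
    Equiv.ext fun a : Fin (m + 1) => (finRotate_apply a).symm
  rw [← sign_finRotate (m + 1), ← h]
  rfl

/-- This splits `σ` as `z * (z⁻¹ * σ)`, with `z` the part of `σ` that `τ` can see, without writing
`σ` as the product of all its cycles. -/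
theorem Equiv.Perm.disjoint_inv_mul {α : Type*} {σ z : Perm α} {τ : Perm α}
    (h : ∀ x, τ x = x ∨ z x = σ x) : τ.Disjoint (z⁻¹ * σ) := fun x =>
  (h x).imp_right fun hx => by
    rw [Perm.mul_apply, ← hx, ← Perm.mul_apply, inv_mul_cancel, Perm.one_apply]

namespace CycleLabelling

variable {σ : Perm (Fin n)} (φ : CycleLabelling σ)

/-- The `j`-th `k`-cycle of `σ`. -/
def cycle (k : Finset.Icc 1 n) (j : Fin (numCycles σ k)) : Perm (Fin n) :=
  φ.hom (Pi.mulSingle k (SemidirectProduct.inl (Pi.mulSingle j (Multiplicative.ofAdd 1))))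

theorem cycle_apply (k : Finset.Icc 1 n) (j : Fin (numCycles σ k)) (a : ZMod k) :
    φ.cycle k j (φ.toEquiv ⟨k, j, a⟩) = φ.toEquiv ⟨k, j, a + 1⟩ := by
  simp [cycle, hom_apply, cycleAct]

theorem cycle_apply_of_ne {k k' : Finset.Icc 1 n} {j : Fin (numCycles σ k)}
    {j' : Fin (numCycles σ k')} (h : (⟨k', j'⟩ : (k : Finset.Icc 1 n) × Fin (numCycles σ k)) ≠ ⟨k, j⟩)
    (a : ZMod k') : φ.cycle k j (φ.toEquiv ⟨k', j', a⟩) = φ.toEquiv ⟨k', j', a⟩ := by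
  rw [cycle, hom_apply]
  congr 1
  by_cases hk : k' = k
  · subst hk
    have hj : j' ≠ j := fun hj => h (hj ▸ rfl)
    simp [cycleAct, hj]
  · simp [cycleAct, hk]

theorem cycle_apply_eq (k : Finset.Icc 1 n) (j : Fin (numCycles σ k)) (x : Fin n) :
    φ.cycle k j x = x ∨ φ.cycle k j x = σ x := by
  obtain ⟨⟨k', j', a⟩, rfl⟩ := φ.toEquiv.surjective x
  by_cases h : (⟨k', j'⟩ : (k : Finset.Icc 1 n) × Fin (numCycles σ k)) = ⟨k, j⟩
  · cases h
    exact Or.inr (by rw [cycle_apply, φ.map_succ])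
  · exact Or.inl (φ.cycle_apply_of_ne h a)

theorem disjoint_cycle (k : Finset.Icc 1 n) {i j : Fin (numCycles σ k)} (hij : i ≠ j) :
    (φ.cycle k i).Disjoint (φ.cycle k j) := by
  intro x
  obtain ⟨⟨k', j', a⟩, rfl⟩ := φ.toEquiv.surjective x
  by_cases h : (⟨k', j'⟩ : (k : Finset.Icc 1 n) × Fin (numCycles σ k)) = ⟨k, i⟩
  · cases h
    exact Or.inr (φ.cycle_apply_of_ne (by simpa using hij) a)
  · exact Or.inl (φ.cycle_apply_of_ne h a)

/-- The cycle is translation by `1` on an embedded copy of `ℤ/k`, of sign `(-1)^(k-1)`; for `k = 1`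
it is the identity and the formula still holds. -/
theorem sign_cycle (k : Finset.Icc 1 n) (j : Fin (numCycles σ k)) :
    Perm.sign (φ.cycle k j) = if Even (k : ℕ) then -1 else 1 := by
  have hk1 : 1 ≤ (k : ℕ) := (Finset.mem_Icc.1 k.2).1
  have : NeZero (k : ℕ) := ⟨by omega⟩
  let f : ZMod k ↪ Fin n := ⟨fun a => φ.toEquiv ⟨k, j, a⟩, fun a b h => by
    simpa using φ.toEquiv.injective h⟩
  have hc : φ.cycle k j = (Equiv.addRight (1 : ZMod k)).viaFintypeEmbedding f := by
    refine φ.perm_ext ?_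
    rintro ⟨k', j', a⟩
    by_cases h : (⟨k', j'⟩ : (k : Finset.Icc 1 n) × Fin (numCycles σ k)) = ⟨k, j⟩
    · cases h
      rw [cycle_apply]
      exact (Perm.viaFintypeEmbedding_apply_image (Equiv.addRight (1 : ZMod k)) f a).symm
    · rw [φ.cycle_apply_of_ne h, Perm.viaFintypeEmbedding_apply_notMem_range]
      rintro ⟨b, hb⟩
      have := φ.toEquiv.injective hb
      cases this
      exact h rfl
  rw [hc, Perm.viaFintypeEmbedding_sign, sign_addRight_one]
  split_ifs with hk
  · exact (Nat.Even.sub_odd hk1 hk odd_one).neg_one_pow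
  · exact (Nat.Odd.sub_odd (Nat.not_even_iff_odd.1 hk) odd_one).neg_one_pow

theorem superSign_cycle (k : Finset.Icc 1 n) (j : Fin (numCycles σ k)) :
    superSign σ (φ.cycle k j) = Perm.sign (φ.cycle k j) := by
  have h := superSign_mul_self (Perm.disjoint_inv_mul (φ.cycle_apply_eq k j))
  rwa [mul_inv_cancel_left] at h

/-- The exchange is disjoint from all of `σ` except the two cycles it swaps, so
`superSign_mul_of_conj` applies to their product. -/
theorem superSign_hom_swap (k : Finset.Icc 1 n) {i j : Fin (numCycles σ k)} (hij : i ≠ j) :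
    superSign σ (φ.hom (Pi.mulSingle k (SemidirectProduct.inr (swap i j)))) =
      Perm.sign (φ.cycle k i) := by
  set τ := φ.hom (Pi.mulSingle k (SemidirectProduct.inr (swap i j))) with hτ
  have hdisj : τ.Disjoint ((φ.cycle k i * φ.cycle k j)⁻¹ * σ) := by
    refine Perm.disjoint_inv_mul fun x => ?_
    obtain ⟨⟨k', j', a⟩, rfl⟩ := φ.toEquiv.surjective x
    rw [hτ, hom_apply, φ.toEquiv.apply_eq_iff_eq]
    by_cases hk : k' = k
    · subst hk
      by_cases hi : j' = i
      · subst hi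
        rw [Perm.mul_apply, φ.cycle_apply_of_ne (by simpa using hij), cycle_apply, φ.map_succ]
        exact Or.inr rfl
      · by_cases hj : j' = j
        · subst hj
          rw [Perm.mul_apply, cycle_apply, φ.cycle_apply_of_ne (by simpa using hi), φ.map_succ]
          exact Or.inr rfl
        · left
          simp [cycleAct, swap_apply_of_ne_of_ne hi hj]
    · left
      simp [cycleAct, hk]
  have hinv : τ * τ = 1 := by
    rw [hτ, ← map_mul, ← Pi.mulSingle_mul, ← map_mul, swap_mul_self, map_one, Pi.mulSingle_one,
      map_one]
  have hconj : τ * φ.cycle k i * τ⁻¹ = φ.cycle k j := by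
    rw [hτ, cycle, cycle, ← map_inv, ← map_mul, ← map_mul, ← Pi.mulSingle_inv, ← Pi.mulSingle_mul,
      ← Pi.mulSingle_mul, ← map_inv, ← SemidirectProduct.inl_aut]
    congr 3
    funext m
    change (Pi.mulSingle i (Multiplicative.ofAdd 1) : Fin _ → _) ((swap i j)⁻¹ m) = _
    simp only [swap_inv, Pi.mulSingle_apply, swap_apply_eq_iff, swap_apply_left]
  have hσ : Commute σ τ := φ.commute_hom _
  have hc : Commute (φ.cycle k i * φ.cycle k j) τ := by
    have := hσ.mul_left hdisj.symm.commute.inv_left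
    rwa [mul_inv_rev, inv_inv, mul_inv_cancel_left] at this
  have h := superSign_mul_left hc hdisj.symm.commute
  rwa [mul_inv_cancel_left, superSign_of_disjoint hdisj.symm, mul_one,
    superSign_mul_of_conj (φ.disjoint_cycle k hij) hinv hconj] at h

/-- The supersymbol with `σ` as a homomorphism on `∏ₖ ℤ/k ≀ S_{N_k}`. -/
noncomputable def superSignHom : CycleGroup σ →* ℤˣ where
  toFun w := superSign σ (φ.hom w)
  map_one' := by rw [map_one, superSign_one_right]
  map_mul' w w' := by rw [map_mul, superSign_mul_right (φ.commute_hom w) (φ.commute_hom w')]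

/-- Two homomorphisms are compared on generators: one rotation for each cycle and the transpositions
of each `S_{N_k}`. -/
theorem superSignHom_eq : φ.superSignHom = cycleSign σ := by
  refine MonoidHom.pi_ext fun k x => ?_
  let ι := MonoidHom.mulSingle
    (fun k : Finset.Icc 1 n => Wreath (Multiplicative (ZMod k)) (numCycles σ k)) k
  refine DFunLike.congr_fun (f := φ.superSignHom.comp ι) (g := (cycleSign σ).comp ι) ?_ x
  refine SemidirectProduct.hom_ext ?_ ?_
  · refine MonoidHom.functions_ext _ _ _ fun j a => ?_
    have key : superSign σ (φ.cycle k j) = cycleSign σ (Pi.mulSingle k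
        (SemidirectProduct.inl (Pi.mulSingle j (Multiplicative.ofAdd 1)))) := by
      rw [superSign_cycle, sign_cycle, cycleSign_mulSingle]
      split_ifs with hk
      · rw [wreathSign_apply, SemidirectProduct.right_inl, map_one, one_mul,
          SemidirectProduct.left_inl, Fintype.prod_eq_single j, Pi.mulSingle_eq_same,
          spinSign_ofAdd_one]
        intro i hi
        rw [Pi.mulSingle_eq_of_ne hi, map_one]
      · rfl
    have : NeZero (k : ℕ) := ⟨by have := (Finset.mem_Icc.1 k.2).1; omega⟩
    have ha : a = (Multiplicative.ofAdd (1 : ZMod k)) ^ (a.toAdd.val) := by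
      rw [← ofAdd_nsmul, nsmul_one, ZMod.natCast_zmod_val, ofAdd_toAdd]
    rw [ha, ← MonoidHom.mulSingle_apply, map_pow, map_pow, map_pow]
    exact congrArg (· ^ _) key
  · refine MonoidHom.ext fun π => ?_
    induction π using Perm.swap_induction_on with
    | one => rw [map_one, map_one]
    | swap_mul π i j hij ih =>
      rw [map_mul, map_mul, ih]
      congr 1
      change superSign σ (φ.hom (Pi.mulSingle k (SemidirectProduct.inr (swap i j)))) =
        cycleSign σ (Pi.mulSingle k (SemidirectProduct.inr (swap i j)))
      rw [superSign_hom_swap _ _ hij, sign_cycle, cycleSign_mulSingle]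
      split_ifs with hk
      · simp [wreathSign_apply, Perm.sign_swap hij]
      · rfl

theorem superSign_hom (w : CycleGroup σ) : superSign σ (φ.hom w) = cycleSign σ w :=
  DFunLike.congr_fun φ.superSignHom_eq w

end CycleLabelling

/-- The character formula is applied to `σ` itself, which corresponds to shifting every cycle by
`1`. There the supersymbol is `sgn σ`, while `cycleSign` counts the cycles of even length. -/
theorem permDeg_eq_sum (σ : Perm (Fin n)) :
    permDeg σ = ∑ k : {k : Finset.Icc 1 n // Even (k : ℕ)}, (numCycles σ k.1 : ZMod 2) := by
  obtain ⟨φ⟩ := nonempty_cycleLabelling σ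
  have hσ : φ.hom (fun k => ⟨fun _ => Multiplicative.ofAdd 1, 1⟩) = σ := by
    refine φ.perm_ext ?_
    rintro ⟨k, j, a⟩
    rw [φ.hom_apply, φ.map_succ]
    rfl
  have hs := φ.superSign_hom fun k => ⟨fun _ => Multiplicative.ofAdd 1, 1⟩
  rw [hσ, superSign, commSign_self, koszulSign_self, mul_one, cycleSign_apply] at hs
  simp only [wreathSign_apply, map_one, one_mul, spinSign_ofAdd_one, Finset.prod_const,
    Finset.card_univ, Fintype.card_fin, Finset.prod_pow_eq_pow_sum] at hs
  rw [← Nat.cast_sum, permDeg, hs]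
  generalize ∑ k : {k : Finset.Icc 1 n // Even (k : ℕ)}, numCycles σ k.1 = m
  rcases Nat.even_or_odd m with h | h
  · rw [h.neg_one_pow, if_pos rfl, (ZMod.natCast_eq_zero_iff_even).2 h]
  · rw [h.neg_one_pow, if_neg (by decide), (ZMod.natCast_eq_one_iff_odd).2 h]

end

/-! ### Lines and their tensor products -/

namespace SuperRep

variable {𝕜 : Type u} [Field 𝕜]

/-- `X` is spanned by a vector of degree `d` on which the group acts by the character `χ`. -/
def IsLine {G : Type*} [Group G] (X : SuperRep 𝕜 G) (χ : G →* 𝕜ˣ) (d : ZMod 2) : Prop :=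
  ∃ e : 𝕜 ≃ₗ[𝕜] X.V, e 1 ∈ X.grading d ∧ ∀ g, X.ρ g (e 1) = (χ g : 𝕜) • e 1

theorem isLine_line {G : Type*} [Group G] (χ : G →* 𝕜ˣ) (d : ZMod 2) : (line χ d).IsLine χ d := by
  refine ⟨LinearEquiv.refl 𝕜 𝕜, ?_, fun g => rfl⟩
  change (1 : 𝕜) ∈ (if d = d then ⊤ else ⊥ : Submodule 𝕜 𝕜)
  rw [if_pos rfl]
  trivial

theorem IsLine.nonempty_iso {G : Type*} [Group G] {X : SuperRep 𝕜 G} {χ : G →* 𝕜ˣ} {d : ZMod 2}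
    (h : X.IsLine χ d) : Nonempty (Iso (line χ d) X) := by
  obtain ⟨e, hd, hχ⟩ := h
  have he : ∀ v : 𝕜, e v = v • e 1 := fun v => by rw [← map_smul, smul_eq_mul, mul_one]
  have hmem : ∀ (d' : ZMod 2) (v : 𝕜), v ∈ (if d' = d then ⊤ else ⊥ : Submodule 𝕜 𝕜) →
      e v ∈ X.grading d' := fun d' v hv => by
    split_ifs at hv with h
    · rw [he, h]
      exact Submodule.smul_mem _ _ hd
    · rw [(Submodule.mem_bot 𝕜).1 hv, map_zero]
      exact zero_mem _
  have hρ : ∀ (g : G) (v : 𝕜), e ((χ g : 𝕜) * v) = X.ρ g (e v) := fun g v => by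
    rw [he, he v, map_smul, hχ, smul_smul, mul_comm]
  exact ⟨{ toEquiv := e, map_mem := hmem, map_ρ := hρ }⟩

theorem IsLine.comap {G H : Type*} [Group G] [Group H] {X : SuperRep 𝕜 H} {χ : H →* 𝕜ˣ}
    {d : ZMod 2} (h : X.IsLine χ d) (f : G →* H) : (X.comap f).IsLine (χ.comp f) d := by
  obtain ⟨e, hd, hχ⟩ := h
  exact ⟨e, hd, fun g => hχ (f g)⟩

theorem exists_tensor_equiv {ι : Type} [Fintype ι] {V : ι → Type u} [∀ i, AddCommGroup (V i)]
    [∀ i, Module 𝕜 (V i)] (e : ∀ i, 𝕜 ≃ₗ[𝕜] V i) :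
    ∃ E : 𝕜 ≃ₗ[𝕜] (⨂[𝕜] i, V i), E 1 = PiTensorProduct.tprod 𝕜 fun i => e i 1 :=
  ⟨(PiTensorProduct.constantBaseRingEquiv ι 𝕜).symm.toLinearEquiv.trans (PiTensorProduct.congr e),
    (congrArg (PiTensorProduct.congr e)
      (map_one (PiTensorProduct.constantBaseRingEquiv ι 𝕜).symm)).trans
        (PiTensorProduct.congr_tprod e fun _ => (1 : 𝕜))⟩

/-- The generator `e 1 ⊗ ⋯ ⊗ e 1` is unchanged by permuting its factors, so only `sgn(π)` and the
scalars `χ(fⱼ)` remain. -/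
theorem IsLine.wreathSgn {H : Type} [Group H] {X : SuperRep 𝕜 H} {χ : H →* ℤˣ} {d : ZMod 2}
    (h : X.IsLine ((signToUnits 𝕜).comp χ) d) (N : ℕ) :
    (X.wreathSgn N).IsLine ((signToUnits 𝕜).comp (wreathSign χ N)) (N * d) := by
  obtain ⟨e, hd, hχ⟩ := h
  obtain ⟨E, hE⟩ := exists_tensor_equiv fun _ : Fin N => e
  have hmem : E 1 ∈ tensorGrading (fun _ : Fin N => X.grading) (N * d) :=
    Submodule.subset_span ⟨fun _ => d, fun _ => e 1, by simp, fun _ => hd, hE⟩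
  have hρ : ∀ w : Wreath H N, wreathSgnMap X N w (E 1) =
      (((signToUnits 𝕜).comp (wreathSign χ N)) w : 𝕜) • E 1 := fun w => by
    rw [hE, wreathSgnMap_tprod]
    simp only [hχ]
    rw [MultilinearMap.map_smul_univ, smul_smul, MonoidHom.comp_apply, wreathSign_apply, map_mul,
      map_prod, Units.val_mul, Units.coe_prod]
    rfl
  exact ⟨E, hmem, hρ⟩

theorem IsLine.tensor {ι : Type} [Fintype ι] {G : ι → Type} [∀ i, Group (G i)]
    {W : ∀ i, SuperRep 𝕜 (G i)} {χ : ∀ i, G i →* 𝕜ˣ} {d : ι → ZMod 2}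
    (h : ∀ i, (W i).IsLine (χ i) (d i)) {ψ : (∀ i, G i) →* 𝕜ˣ} (hψ : ∀ g, ψ g = ∏ i, χ i (g i)) :
    (SuperRep.tensor W).IsLine ψ (∑ i, d i) := by
  choose e hd hχ using h
  obtain ⟨E, hE⟩ := exists_tensor_equiv e
  have hmem : E 1 ∈ tensorGrading (fun i => (W i).grading) (∑ i, d i) :=
    Submodule.subset_span ⟨d, fun i => e i 1, rfl, hd, hE⟩
  have hρ : ∀ g : ∀ i, G i, PiTensorProduct.map (fun i => (W i).ρ (g i)) (E 1) =
      (ψ g : 𝕜) • E 1 := fun g => by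
    rw [hE, PiTensorProduct.map_tprod]
    simp only [hχ]
    rw [MultilinearMap.map_smul_univ, hψ, Units.coe_prod]
  exact ⟨E, hmem, hρ⟩

end SuperRep

/-! ### The spin superrepresentation as a line, and the theorem -/

theorem isLine_spinTensor (𝕜 : Type u) [Field 𝕜] {n : ℕ} (σ : Equiv.Perm (Fin n)) :
    (spinTensor 𝕜 σ).IsLine ((signToUnits 𝕜).comp (cycleSign σ)) (permDeg σ) := by
  have h : ∀ k : {k : Finset.Icc 1 n // Even (k : ℕ)},
      ((rhoSpin 𝕜 k.1 k.2).wreathSgn (numCycles σ k.1)).IsLine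
        ((signToUnits 𝕜).comp (wreathSign (spinSign k.1 k.2) (numCycles σ k.1)))
        (numCycles σ k.1 * 1) := fun k =>
    -- `chiSpin` is by definition `spinSign` followed by `signToUnits`.
    SuperRep.IsLine.wreathSgn (SuperRep.isLine_line (chiSpin 𝕜 k.1 k.2) 1) _
  let ψ : (∀ k : {k : Finset.Icc 1 n // Even (k : ℕ)},
      Wreath (Multiplicative (ZMod k.1)) (numCycles σ k.1)) →* 𝕜ˣ :=
    { toFun := fun g => ∏ k : {k : Finset.Icc 1 n // Even (k : ℕ)},
        signToUnits 𝕜 (wreathSign (spinSign k.1 k.2) (numCycles σ k.1) (g k))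
      map_one' := by simp
      map_mul' := fun g h => by simp [Finset.prod_mul_distrib] }
  have hd : permDeg σ =
      ∑ k : {k : Finset.Icc 1 n // Even (k : ℕ)}, (numCycles σ k.1 * 1 : ZMod 2) := by
    simp [permDeg_eq_sum]
  have hc : (signToUnits 𝕜).comp (cycleSign σ) = ψ.comp
      { toFun := fun w k => w k.1
        map_one' := rfl
        map_mul' := fun _ _ => rfl } := by
    ext1 w
    exact map_prod (signToUnits 𝕜) _ _
  rw [hd, hc]
  exact (SuperRep.IsLine.tensor h fun _ => rfl).comap _

theorem mainTheorem5 (𝕜 : Type u) [Field 𝕜] (n : ℕ) (σ : Equiv.Perm (Fin n))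
    (l : Equiv.Perm (Fin n) → SchurCover n) (hl : ∀ τ, schurProj n (l τ) = τ) :
    Nonempty (CycleLabelling σ) ∧
    ∀ φ : CycleLabelling σ,
      ∃ Ψ : Subgroup.centralizer {σ} ≃* CycleGroup σ,
        (∀ w : CycleGroup σ, ((Ψ.symm w : Subgroup.centralizer {σ}) : Equiv.Perm (Fin n)) =
          φ.hom w) ∧
        ∃ χ : Subgroup.centralizer {σ} →* 𝕜ˣ,
          (∀ τ : Subgroup.centralizer {σ},
            χ τ = supersymbol permDeg (schurCocycle 𝕜 l) σ (τ : Equiv.Perm (Fin n))) ∧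
          Nonempty (SuperRep.Iso (SuperRep.line χ (permDeg σ))
            (SuperRep.comap Ψ.toMonoidHom (spinTensor 𝕜 σ))) := by
  refine ⟨nonempty_cycleLabelling σ, fun φ => ⟨φ.mulEquiv.symm, φ.coe_mulEquiv,
    ((signToUnits 𝕜).comp (cycleSign σ)).comp φ.mulEquiv.symm.toMonoidHom, fun τ => ?_, ?_⟩⟩
  · obtain ⟨w, rfl⟩ := φ.mulEquiv.surjective τ
    rw [φ.coe_mulEquiv, supersymbol_eq 𝕜 hl (φ.commute_hom w), φ.superSign_hom]
    simp
  · exact ((isLine_spinTensor 𝕜 σ).comap _).nonempty_iso
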